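/- **Setting.** Consider a stochastic bandit with arms $1,\dots,K$ ($K\ge 1$) and horizon $T\ge 1$. An environment $\mathcal F$ assigns to each arm $k$ and time $t\in\{1,\dots,T\}$ a probability distribution $f_t^k$ on $\mathbb R$. At time $t$ a policy $\rho$ selects an arm $\varphi_t$ (possibly at random) on the basis of the past observations $(\varphi_s,X_s)_{s<t}$; given these and $\varphi_t=k$, the reward $X_t$ is drawn from $f_t^k$. Let $\mu_t^k$ be the mean of $f_t^k$, $\mu_t^*=\max_k\mu_t^k$, and $$R_T^\rho=\sum_{t=1}^T\mu_t^*-\mathbb E^\rho\Big[\sum_{t=1}^T X_t\Big].$$ For $V>0$ let $\mathcal E(V,T,K)$ be the set of environments such that $\int x^2\,f_t^k(dx)\le 1$ for all $k$ and $t$ (heavy-tailed rewards) and $\sum_{t=1}^{T-1}\max_k|\mu_{t+1}^k-\mu_t^k|\le V$. **Policy.** Let $a>1$, $\zeta>0$, $\ln_+(x)=\max(\ln x,1)$, $\psi(x)=(1+1/x)\ln(1+x)-1$, $h(m)=a^{\lfloor\log_a m\rfloor+1}$, $\mathrm{sat}(x,B)=\mathrm{sign}(x)\min\{|x|,B\}$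 and, for $\tau\ge 1$, $$B_m=\sqrt{\frac{h(m)}{\ln_+\big(\tau/(K h(m))\big)}},\qquad c_m=\sqrt{\frac{\ln_+\big(\tau/(Km)\big)}{m}}.$$ Resetting Robust MOSS (R-RMOSS) with period $\tau$ splits time into the epochs $\{1,\dots,\tau\},\{\tau+1,\dots,2\tau\},\dots$ and in each epoch uses only the data of that epoch. At time $t$ let $n_k$ be the number of earlier selections of arm $k$ in the current epoch. If some arms have $n_k=0$, one of them is selected. Otherwise an arm is selected that maximizes $$\frac1{n_k}\sum_{s}\mathrm{sat}(X_s,B_{n_k})+(1+\zeta)\,c_{n_k},$$ where the sum is over the earlier times $s$ in the current epoch with $\varphi_s=k$. The order of the initial selections and the tie-breaking are arbitrary. **Theorem.** Let $a>1$ and $\zeta>0$ satisfy $\psi(2\zeta/a)\ge 2a/\zeta$. There is a constant $C>0$, depending only on $a$ and $\zeta$, such that for all integers $K,T\ge 1$ and all $V>0$ for which $$\tau=\Big\lceil K^{1/3}(T/V)^{2/3}\Big\rceil\le T,$$ every R-RMOSS policy with parameters $a,\zeta$ and period $\tau$ satisfies $$\sup_{\mathcal F\in\mathcal E(V,T,K)}R_T^{\text{R-RMOSS}}\le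 C\,(KV)^{1/3}\,T^{2/3}.$$ -/

import Mathlib

open MeasureTheory ProbabilityTheory

noncomputable section

namespace NonstationaryBandit

/-! Time slots are numbered `0, 1, 2, …`, and arms are the elements of `Fin K`. -/

/-- The reward distributions: `F t k` is the distribution of the reward of arm `k` at time `t`.
For a horizon `T` only the distributions at times `t < T` matter. -/
abbrev Environment (K : ℕ) := ℕ → Fin K → ProbabilityMeasure ℝ

/-- The selected arms and the observed rewards of the first `t` time slots. -/
abbrev History (K t : ℕ) := Fin t → Fin K × ℝ

/-- A (possibly randomized) policy: for every time `t`, the conditional distribution of the arm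
selected at time `t`, given the past observations. -/
structure Policy (K : ℕ) where
  kernel : (t : ℕ) → Kernel (History K t) (Fin K)
  markov : ∀ t, IsMarkovKernel (kernel t)

/-! ### Environments -/

/-- The mean reward of arm `k` at time `t`. -/
def mean {K : ℕ} (F : Environment K) (t : ℕ) (k : Fin K) : ℝ :=
  ∫ x, x ∂(F t k : Measure ℝ)

/-- The mean reward of the best arm at time `t`. -/
def bestMean {K : ℕ} (F : Environment K) (t : ℕ) : ℝ := ⨆ k, mean F t k

/-- The total variation of the mean rewards over the `T` time slots `0, …, T - 1`. -/
def totalVariation {K : ℕ} (F : Environment K) (T : ℕ) : ℝ :=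
  ∑ t ∈ Finset.range (T - 1), ⨆ k, |mean F (t + 1) k - mean F t k|

/-- Heavy-tailed rewards: `E[X²] ≤ 1` for all arms and all time slots up to the horizon. -/
def HeavyTailed {K : ℕ} (F : Environment K) (T : ℕ) : Prop :=
  ∀ t < T, ∀ k, ∫⁻ x, ENNReal.ofReal (x ^ 2) ∂(F t k : Measure ℝ) ≤ 1

/-- Heavy-tailed environments with total variation at most `V`. -/
def envClass (V : ℝ) (T K : ℕ) : Set (Environment K) :=
  {F | HeavyTailed F T ∧ totalVariation F T ≤ V}

/-! ### Interaction of a policy with an environment -/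

/-- The reward distribution at time `t`, as a kernel from the selected arm. -/
def rewardKernel {K : ℕ} (F : Environment K) (t : ℕ) : Kernel (Fin K) ℝ :=
  Kernel.ofFunOfCountable fun k => (F t k : Measure ℝ)

/-- The law of the history of the first `t` time slots: given the history `h` of the first `t`
slots, the next arm `k` is drawn from `π.kernel t h`, and then, given `h` and `k`, the reward is
drawn from `F t k`. -/
def historyLaw {K : ℕ} (π : Policy K) (F : Environment K) : (t : ℕ) → Measure (History K t)
  | 0 => Measure.dirac Fin.elim0
  | t + 1 =>
    (historyLaw π F t ⊗ₘ
      (π.kernel t ⊗ₖ Kernel.prodMkLeft (History K t) (rewardKernel F t))).map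
        fun p => (Fin.snoc p.1 p.2 : History K (t + 1))

/-- The regret `∑_t μ_t^* - E[S_T]`, where `S_T` is the cumulative reward. -/
def regret {K : ℕ} (π : Policy K) (F : Environment K) (T : ℕ) : ℝ :=
  ∑ t ∈ Finset.range T, bestMean F t - ∫ h, ∑ t : Fin T, (h t).2 ∂(historyLaw π F T)

/-- The worst-case regret over the environments with variation budget `V`. -/
def worstCaseRegret {K : ℕ} (π : Policy K) (V : ℝ) (T : ℕ) : EReal :=
  ⨆ F ∈ envClass V T K, (regret π F T : EReal)

/-! ### Resetting Robust MOSS -/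

/-- `ln₊ x = max (ln x) 1`. -/
def lnPlus (x : ℝ) : ℝ := max (Real.log x) 1

/-- `ψ x = (1 + 1 / x) ln (1 + x) - 1`. -/
def psi (x : ℝ) : ℝ := (1 + 1 / x) * Real.log (1 + x) - 1

/-- `h(m) = a ^ (⌊log_a m⌋ + 1)`. -/
def gridUp (a : ℝ) (m : ℕ) : ℝ := a ^ (⌊Real.logb a m⌋ + 1)

/-- The saturation limit `B_m` of Robust MOSS with `K` arms and horizon `τ`. -/
def satLimit (a : ℝ) (τ K m : ℕ) : ℝ :=
  √(gridUp a m / lnPlus (τ / (K * gridUp a m)))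

/-- `sat(x, B) = sign(x) min {|x|, B}`. -/
def sat (x B : ℝ) : ℝ := Real.sign x * min |x| B

/-- `c_m` of Robust MOSS with `K` arms and horizon `τ`. -/
def confWidth (τ K m : ℕ) : ℝ := √(lnPlus (τ / (K * m)) / m)

/-- The past time slots `s < t` that lie in the same epoch as `t` and in which arm `k` was
selected; the epochs are `{0, …, τ - 1}`, `{τ, …, 2τ - 1}`, …. -/
def pulls {K t : ℕ} (τ : ℕ) (h : History K t) (k : Fin K) : Finset (Fin t) :=
  {s | (s : ℕ) / τ = t / τ ∧ (h s).1 = k}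

/-- The saturated empirical mean of arm `k` in the current epoch. -/
def satMean {K t : ℕ} (a : ℝ) (τ : ℕ) (h : History K t) (k : Fin K) : ℝ :=
  (∑ s ∈ pulls τ h k, sat (h s).2 (satLimit a τ K (pulls τ h k).card)) / (pulls τ h k).card

/-- The upper confidence bound of arm `k`, computed from the data of the current epoch. -/
def ucb {K t : ℕ} (a ζ : ℝ) (τ : ℕ) (h : History K t) (k : Fin K) : ℝ :=
  satMean a τ h k + (1 + ζ) * confWidth τ K (pulls τ h k).card

/-- Robust MOSS, run on the data of the current epoch with horizon `τ`, may select arm `k` after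
the history `h`: as long as some arm has not been selected in the epoch, one of those arms is
selected; afterwards an arm with maximal upper confidence bound. -/
def Admissible {K t : ℕ} (a ζ : ℝ) (τ : ℕ) (h : History K t) (k : Fin K) : Prop :=
  pulls τ h k = ∅ ∨ ((∀ j, pulls τ h j ≠ ∅) ∧ ∀ j, ucb a ζ τ h j ≤ ucb a ζ τ h k)

/-- `π` is a Resetting Robust MOSS policy with parameters `a`, `ζ` that restarts every `τ` time
slots. The order of the initial selections and the tie-breaking are arbitrary. -/
def IsRRMOSS {K : ℕ} (a ζ : ℝ) (τ : ℕ) (π : Policy K) : Prop :=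
  ∀ (t : ℕ) (h : History K t), ∀ᵐ k ∂(π.kernel t h), Admissible a ζ τ h k

/-- The epoch length `⌈K^{1/3} (T / V)^{2/3}⌉`. -/
def resetPeriod (K T : ℕ) (V : ℝ) : ℕ :=
  ⌈(K : ℝ) ^ (1 / 3 : ℝ) * ((T : ℝ) / V) ^ (2 / 3 : ℝ)⌉₊

end NonstationaryBandit

end

/-!
Within an epoch the means move by at most the variation of that epoch, so up to this drift its
environment is stationary. For bounded increments, Bennett's inequality turns the sum of the
saturated and centred rewards of an arm into an exponential supermartingale. Peeling over the grid
`a ^ s`, on which the saturation limit is constant, and using the hypothesis on `ψ` to beat the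
logarithm in `c_m`, one controls the deviations simultaneously for all numbers of selections.

An arm of gap `Δ` is selected only if `Δ` is at most of the order of the drift, of the
underestimation of the best arm, or of the critical gap `√(K / τ)`, or if the arm has been tried
rarely, or if it is overestimated by `Δ / 6`. The first alternatives cost `O(√(K / τ))` plus the
drift per time slot; the last ones cost `O(√(τ / K))` per arm and epoch. An epoch thus costs
`O(√(K τ))` plus `8 τ` times its variation. Summing over at most `2 T / τ` epochs gives
`O(T √(K / τ) + τ V)`, and `τ = K^{1/3} (T / V)^{2/3}` balances the two terms.
-/

open MeasureTheory ProbabilityTheory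

noncomputable section

namespace NonstationaryBandit

/-! ### Bennett's inequality -/

section Bennett

/-- The function `b ↦ (exp b - 1 - b) / b²` governing the variance term in Bennett's inequality. -/
def bennett (b : ℝ) : ℝ := (Real.exp b - 1 - b) / b ^ 2

lemma bennett_nonneg (b : ℝ) : 0 ≤ bennett b :=
  div_nonneg (by linarith [Real.add_one_le_exp b]) (sq_nonneg b)

lemma hasSum_exp_sub_one_sub (y : ℝ) :
    HasSum (fun n : ℕ => y ^ (n + 2) / ((n + 2).factorial : ℝ)) (Real.exp y - 1 - y) := by
  have h : HasSum (fun n : ℕ => y ^ n / (n.factorial : ℝ)) (Real.exp y) := by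
    rw [Real.exp_eq_exp_ℝ]
    exact NormedSpace.expSeries_div_hasSum_exp y
  simpa [Finset.sum_range_succ, sub_sub] using (hasSum_nat_add_iff' 2).2 h

lemma exp_le_one_add_add_bennett_mul_sq {y b : ℝ} (h : |y| ≤ b) :
    Real.exp y ≤ 1 + y + bennett b * y ^ 2 := by
  rcases (abs_nonneg y |>.trans h).eq_or_lt with rfl | hb
  · simp [abs_nonpos_iff.1 h]
  have hsum := (hasSum_exp_sub_one_sub b).mul_left (y ^ 2 / b ^ 2)
  have hle : Real.exp y - 1 - y ≤ y ^ 2 / b ^ 2 * (Real.exp b - 1 - b) := by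
    refine hasSum_le (fun n => ?_) (hasSum_exp_sub_one_sub y) hsum
    have hpow : y ^ n ≤ b ^ n :=
      (le_abs_self _).trans (abs_pow y n ▸ pow_le_pow_left₀ (abs_nonneg y) h n)
    calc y ^ (n + 2) / ((n + 2).factorial : ℝ) = y ^ 2 * y ^ n / (n + 2).factorial := by
          rw [pow_add, mul_comm]
      _ ≤ y ^ 2 * b ^ n / (n + 2).factorial := by gcongr
      _ = y ^ 2 / b ^ 2 * (b ^ (n + 2) / (n + 2).factorial) := by rw [pow_add]; field_simp
  calc Real.exp y = 1 + y + (Real.exp y - 1 - y) := by ring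
    _ ≤ 1 + y + y ^ 2 / b ^ 2 * (Real.exp b - 1 - b) := by gcongr
    _ = 1 + y + bennett b * y ^ 2 := by rw [bennett]; ring

variable {Ω : Type*} [MeasurableSpace Ω] {P : Measure Ω} [IsProbabilityMeasure P]

lemma mgf_sub_integral_le_exp_bennett {X : Ω → ℝ} {B b η : ℝ} (hX : AEMeasurable X P)
    (hXB : ∀ᵐ ω ∂P, |X ω| ≤ B) (hη : |η| * (2 * B) ≤ b) :
    mgf (fun ω => X ω - P[X]) P η ≤ Real.exp (η ^ 2 * bennett b * Var[X; P]) := by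
  have hX2 : MemLp X 2 P := .of_bound hX.aestronglyMeasurable B hXB
  have hXi : Integrable X P := hX2.integrable one_le_two
  have hmean_le : |P[X]| ≤ B := by
    simpa using norm_integral_le_of_norm_le_const (μ := P) (f := X) hXB
  have hY : Integrable (fun ω => X ω - P[X]) P := hXi.sub (integrable_const _)
  have hY2 : Integrable (fun ω => (X ω - P[X]) ^ 2) P :=
    (hX2.sub (memLp_const _)).integrable_sq
  have hpt : ∀ᵐ ω ∂P, Real.exp (η * (X ω - P[X]))
      ≤ 1 + η * (X ω - P[X]) + η ^ 2 * bennett b * (X ω - P[X]) ^ 2 := by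
    filter_upwards [hXB] with ω hω
    have hle : |η * (X ω - P[X])| ≤ b := by
      rw [abs_mul]
      refine le_trans ?_ hη
      gcongr
      linarith [abs_sub (X ω) P[X]]
    calc _ ≤ 1 + η * (X ω - P[X]) + bennett b * (η * (X ω - P[X])) ^ 2 :=
          exp_le_one_add_add_bennett_mul_sq hle
      _ = _ := by ring
  have hlin : Integrable (fun ω => 1 + η * (X ω - P[X])) P :=
    (integrable_const _).add (hY.const_mul _)
  calc mgf (fun ω => X ω - P[X]) P η
      ≤ ∫ ω, (1 + η * (X ω - P[X]) + η ^ 2 * bennett b * (X ω - P[X]) ^ 2) ∂P :=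
        integral_mono_of_nonneg (.of_forall fun _ => (Real.exp_pos _).le)
          (hlin.add (hY2.const_mul _)) hpt
    _ = 1 + η ^ 2 * bennett b * Var[X; P] := by
        rw [integral_add hlin (hY2.const_mul _), integral_add (integrable_const _)
          (hY.const_mul _), integral_const_mul, integral_const_mul,
          integral_sub hXi (integrable_const _), variance_eq_integral hX]
        simp
    _ ≤ _ := by linarith [Real.add_one_le_exp (η ^ 2 * bennett b * Var[X; P])]

end Bennett

/-! ### Saturation -/

section Saturation

lemma sat_eq_max_min {x B : ℝ} (hB : 0 ≤ B) : sat x B = max (-B) (min x B) := by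
  unfold sat
  rcases lt_trichotomy x 0 with hx | rfl | hx
  · rw [Real.sign_of_neg hx, abs_of_neg hx, min_eq_left (hx.le.trans hB), neg_one_mul,
      ← max_neg_neg, neg_neg, max_comm]
  · simp [hB]
  · rw [Real.sign_of_pos hx, abs_of_pos hx, one_mul, max_eq_right]
    exact (neg_nonpos.2 hB).trans (le_min hx.le hB)

lemma measurable_sat : Measurable fun p : ℝ × ℝ => sat p.1 p.2 := by
  have hsign : Measurable Real.sign := by
    unfold Real.sign
    exact .ite measurableSet_Iio measurable_const
      (.ite measurableSet_Ioi measurable_const measurable_const)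
  exact (hsign.comp measurable_fst).mul (measurable_fst.abs.min measurable_snd)

lemma measurable_sat_left (B : ℝ) : Measurable fun x => sat x B :=
  measurable_sat.comp (measurable_id.prodMk measurable_const)

lemma abs_sat_le {x B : ℝ} (hB : 0 ≤ B) : |sat x B| ≤ B := by
  rw [sat_eq_max_min hB, abs_le]
  exact ⟨le_max_left _ _, max_le (by linarith) (min_le_right _ _)⟩

lemma abs_sat_le_abs {x B : ℝ} (hB : 0 ≤ B) : |sat x B| ≤ |x| := by
  rw [sat_eq_max_min hB, abs_le]
  exact ⟨(le_min (neg_abs_le x) (by linarith [abs_nonneg x])).trans (le_max_right _ _),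
    max_le (by linarith [abs_nonneg x]) ((min_le_left _ _).trans (le_abs_self x))⟩

lemma abs_sat_sub_le {x B : ℝ} (hB : 0 < B) : |sat x B - x| ≤ x ^ 2 / B := by
  rw [le_div_iff₀ hB, sat_eq_max_min hB.le]
  rcases le_total x B with h | h
  · rw [min_eq_left h]
    rcases le_total (-B) x with h' | h'
    · rw [max_eq_right h', sub_self, abs_zero, zero_mul]; positivity
    · rw [max_eq_left h', abs_of_nonneg (by linarith)]; nlinarith
  · rw [min_eq_right h, max_eq_right (by linarith), abs_of_nonpos (by linarith)]; nlinarith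

variable {μ : Measure ℝ}

lemma integrable_sat [IsFiniteMeasure μ] {B : ℝ} (hB : 0 ≤ B) :
    Integrable (fun x => sat x B) μ :=
  .of_bound (measurable_sat_left B).aestronglyMeasurable B (.of_forall fun _ => abs_sat_le hB)

lemma abs_integral_sat_sub_le [IsFiniteMeasure μ] (hμ : MemLp id 2 μ) {B : ℝ} (hB : 0 < B) :
    |∫ x, sat x B ∂μ - ∫ x, x ∂μ| ≤ (∫ x, x ^ 2 ∂μ) / B := by
  have hid : Integrable (fun x : ℝ => x) μ := hμ.integrable one_le_two
  calc |∫ x, sat x B ∂μ - ∫ x, x ∂μ| = |∫ x, (sat x B - x) ∂μ| := by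
        rw [integral_sub (integrable_sat hB.le) hid]
    _ ≤ ∫ x, |sat x B - x| ∂μ := abs_integral_le_integral_abs
    _ ≤ ∫ x, x ^ 2 / B ∂μ :=
        integral_mono ((integrable_sat hB.le).sub hid).abs (hμ.integrable_sq.div_const B)
          fun _ => abs_sat_sub_le hB
    _ = (∫ x, x ^ 2 ∂μ) / B := integral_div _ _

lemma variance_sat_le [IsProbabilityMeasure μ] (hμ : MemLp id 2 μ) {B : ℝ} (hB : 0 ≤ B) :
    Var[fun x => sat x B; μ] ≤ ∫ x, x ^ 2 ∂μ := by
  have hsat : MemLp (fun x => sat x B) 2 μ :=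
    .of_bound (measurable_sat_left B).aestronglyMeasurable B (.of_forall fun _ => abs_sat_le hB)
  exact (variance_le_expectation_sq hsat.aestronglyMeasurable).trans <|
    integral_mono hsat.integrable_sq hμ.integrable_sq fun x => sq_le_sq.2 (abs_sat_le_abs hB)

lemma lintegral_exp_sat_sub_le_one [IsProbabilityMeasure μ] (hμ : MemLp id 2 μ)
    (hμ1 : ∫ x, x ^ 2 ∂μ ≤ 1) {B b η : ℝ} (hB : 0 ≤ B) (hη : |η| * (2 * B) ≤ b) :
    ∫⁻ x, ENNReal.ofReal (Real.exp (η * (sat x B - ∫ y, sat y B ∂μ) - η ^ 2 * bennett b)) ∂μ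
      ≤ 1 := by
  have hmgf := mgf_sub_integral_le_exp_bennett (P := μ) (measurable_sat_left B).aemeasurable
    (.of_forall fun x => abs_sat_le hB) hη
  have hvar : η ^ 2 * bennett b * Var[fun x => sat x B; μ] ≤ η ^ 2 * bennett b :=
    mul_le_of_le_one_right (mul_nonneg (sq_nonneg η) (bennett_nonneg b))
      ((variance_sat_le hμ hB).trans hμ1)
  have hint : Integrable (fun x => Real.exp (η * (sat x B - ∫ y, sat y B ∂μ))) μ :=
    integrable_exp_mul_of_mem_Icc (a := -B - ∫ y, sat y B ∂μ) (b := B - ∫ y, sat y B ∂μ)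
      ((measurable_sat_left B).sub_const _).aemeasurable
      (.of_forall fun x => by
        obtain ⟨hl, hu⟩ := abs_le.1 (abs_sat_le (x := x) hB)
        constructor <;> linarith)
  simp_rw [Real.exp_sub]
  rw [← ofReal_integral_eq_lintegral_ofReal (hint.div_const _) (.of_forall fun _ => by positivity),
    integral_div, ENNReal.ofReal_le_one, div_le_one (Real.exp_pos _)]
  exact hmgf.trans (Real.exp_le_exp.2 hvar)

end Saturation

section HeavyTailed

lemma memLp_two_of_lintegral_sq_lt_top {Ω : Type*} [MeasurableSpace Ω] {μ : Measure Ω} {f : Ω → ℝ}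
    (hf : AEStronglyMeasurable f μ) (h : ∫⁻ ω, ENNReal.ofReal (f ω ^ 2) ∂μ < ⊤) : MemLp f 2 μ :=
  (memLp_two_iff_integrable_sq hf).2
    ⟨hf.pow 2, (hasFiniteIntegral_iff_ofReal (.of_forall fun _ => sq_nonneg _)).2 h⟩

variable {K T : ℕ} {F : Environment K}

lemma HeavyTailed.memLp (hF : HeavyTailed F T) {t : ℕ} (ht : t < T) (k : Fin K) :
    MemLp id 2 (F t k : Measure ℝ) :=
  memLp_two_of_lintegral_sq_lt_top aestronglyMeasurable_id
    ((hF t ht k).trans_lt ENNReal.one_lt_top)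

lemma HeavyTailed.integral_sq_le_one (hF : HeavyTailed F T) {t : ℕ} (ht : t < T) (k : Fin K) :
    ∫ x, x ^ 2 ∂(F t k : Measure ℝ) ≤ 1 := by
  rw [integral_eq_lintegral_of_nonneg_ae (.of_forall fun x => sq_nonneg x) (by fun_prop)]
  exact ENNReal.toReal_le_of_le_ofReal zero_le_one (by simpa using hF t ht k)

lemma HeavyTailed.abs_mean_le_one (hF : HeavyTailed F T) {t : ℕ} (ht : t < T) (k : Fin K) :
    |mean F t k| ≤ 1 := by
  have hvar := variance_nonneg id (F t k : Measure ℝ)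
  rw [variance_eq_sub (hF.memLp ht k)] at hvar
  exact (sq_le_one_iff_abs_le_one _).1
    ((sub_nonneg.1 hvar).trans (hF.integral_sq_le_one ht k))

lemma HeavyTailed.abs_integral_sat_sub_mean_le (hF : HeavyTailed F T) {t : ℕ} (ht : t < T)
    (k : Fin K) {B : ℝ} (hB : 0 < B) :
    |∫ x, sat x B ∂(F t k : Measure ℝ) - mean F t k| ≤ 1 / B :=
  (abs_integral_sat_sub_le (hF.memLp ht k) hB).trans <| by
    gcongr
    exact hF.integral_sq_le_one ht k

end HeavyTailed

/-! ### Maximal inequalities and tail integrals -/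

section Ville

variable {Ω : Type*} [MeasurableSpace Ω] {P : Measure Ω}

lemma mul_measure_sdiff_add_setLIntegral_le {f : Ω → ENNReal} (hf : Measurable f) {s : Set Ω}
    (hs : MeasurableSet s) (c : ENNReal) :
    c * P (s \ {ω | f ω < c}) + ∫⁻ ω in s ∩ {ω | f ω < c}, f ω ∂P ≤ ∫⁻ ω in s, f ω ∂P := by
  have hlt : MeasurableSet {ω | f ω < c} := measurableSet_lt hf measurable_const
  rw [← lintegral_inter_add_sdiff f s hlt, add_comm]
  gcongr
  rw [← setLIntegral_const]
  exact setLIntegral_mono' (hs.diff hlt) fun ω hω => not_lt.1 hω.2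

-- Ville's inequality: the process is a supermartingale only as long as it stays below `c`.
lemma mul_measure_exists_le_le_lintegral {M : ℕ → Ω → ENNReal} (hM : ∀ t, Measurable (M t))
    {c : ENNReal} {T : ℕ}
    (hstep : ∀ t < T, ∫⁻ ω in {ω | ∀ s ≤ t, M s ω < c}, M (t + 1) ω ∂P
      ≤ ∫⁻ ω in {ω | ∀ s ≤ t, M s ω < c}, M t ω ∂P) :
    c * P {ω | ∃ t ≤ T, c ≤ M t ω} ≤ ∫⁻ ω, M 0 ω ∂P := by
  set N : ℕ → Set Ω := fun t => {ω | ∀ s ≤ t, M s ω < c} with hN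
  have hNm : ∀ t, MeasurableSet (N t) := fun t => by
    simp only [hN, Set.ofPred_forall]
    exact .iInter fun s => .iInter fun _ => measurableSet_lt (hM s) measurable_const
  have hNsucc : ∀ t, N (t + 1) = N t ∩ {ω | M (t + 1) ω < c} := fun t => by
    ext ω
    simp only [hN, Nat.le_succ_iff, or_imp, forall_and, forall_eq, Set.mem_inter_iff,
      Set.mem_ofPred_eq]
  have hmain : ∀ t ≤ T, c * P (N t)ᶜ + ∫⁻ ω in N t, M t ω ∂P ≤ ∫⁻ ω, M 0 ω ∂P := by
    intro t
    induction t with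
    | zero => simpa [hN, Set.compl_eq_univ_sdiff] using
        mul_measure_sdiff_add_setLIntegral_le (P := P) (hM 0) .univ c
    | succ t ih =>
      intro ht
      have hcompl : (N (t + 1))ᶜ ⊆ (N t)ᶜ ∪ N t \ {ω | M (t + 1) ω < c} := by
        rw [hNsucc, Set.compl_inter, Set.sdiff_eq, Set.union_inter_distrib_left]
        exact fun ω hω => ⟨by simp, hω⟩
      calc c * P (N (t + 1))ᶜ + ∫⁻ ω in N (t + 1), M (t + 1) ω ∂P
          ≤ c * (P (N t)ᶜ + P (N t \ {ω | M (t + 1) ω < c}))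
            + ∫⁻ ω in N (t + 1), M (t + 1) ω ∂P := by
            gcongr
            exact (measure_mono hcompl).trans (measure_union_le _ _)
        _ ≤ c * P (N t)ᶜ + ∫⁻ ω in N t, M (t + 1) ω ∂P := by
            rw [mul_add, add_assoc, hNsucc]
            gcongr
            exact mul_measure_sdiff_add_setLIntegral_le (hM (t + 1)) (hNm t) c
        _ ≤ c * P (N t)ᶜ + ∫⁻ ω in N t, M t ω ∂P := by
            gcongr c * P (N t)ᶜ + ?_
            exact hstep t ht
        _ ≤ _ := ih (by omega)
  have hexists : {ω | ∃ t ≤ T, c ≤ M t ω} = (N T)ᶜ := by ext ω; simp [hN]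
  rw [hexists]
  exact le_self_add.trans (hmain T le_rfl)

end Ville

section TailIntegral

variable {Ω : Type*} [MeasurableSpace Ω] {P : Measure Ω}

lemma integral_exp_neg_mul_Ioi {β : ℝ} (hβ : 0 < β) :
    ∫ x in Set.Ioi (0 : ℝ), Real.exp (-(β * x)) = 1 / β := by
  simpa [neg_mul] using integral_exp_mul_Ioi (neg_neg_of_pos hβ) 0

lemma lintegral_ofReal_le_of_exp_tail {ι : Type*} {s : Finset ι} {A β : ι → ℝ} {f : Ω → ℝ}
    (hf : AEMeasurable f P) (hf0 : ∀ ω, 0 ≤ f ω) (hA : ∀ i ∈ s, 0 ≤ A i) (hβ : ∀ i ∈ s, 0 < β i)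
    (htail : ∀ x > 0, P {ω | x < f ω}
      ≤ ENNReal.ofReal (∑ i ∈ s, A i * Real.exp (-(β i * x)))) :
    ∫⁻ ω, ENNReal.ofReal (f ω) ∂P ≤ ENNReal.ofReal (∑ i ∈ s, A i / β i) := by
  have hint : ∀ i ∈ s, IntegrableOn (fun x => A i * Real.exp (-(β i * x))) (Set.Ioi 0) :=
    fun i hi => by
      simpa [IntegrableOn] using (exp_neg_integrableOn_Ioi 0 (hβ i hi)).const_mul (A i)
  have hval : ∫ x in Set.Ioi (0 : ℝ), ∑ i ∈ s, A i * Real.exp (-(β i * x))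
      = ∑ i ∈ s, A i / β i := by
    rw [integral_finsetSum _ hint]
    refine Finset.sum_congr rfl fun i hi => ?_
    rw [integral_const_mul, integral_exp_neg_mul_Ioi (hβ i hi), mul_one_div]
  rw [lintegral_eq_lintegral_meas_lt P (.of_forall hf0) hf, ← hval,
    ofReal_integral_eq_lintegral_ofReal (integrable_finsetSum _ hint)
      (.of_forall fun x => Finset.sum_nonneg fun i hi =>
        mul_nonneg (hA i hi) (Real.exp_pos _).le)]
  exact setLIntegral_mono' measurableSet_Ioi fun x hx => htail x hx

lemma integrable_of_lintegral_ofReal_le {f : Ω → ℝ} {c : ℝ} (hf : AEStronglyMeasurable f P)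
    (hf0 : ∀ ω, 0 ≤ f ω) (h : ∫⁻ ω, ENNReal.ofReal (f ω) ∂P ≤ ENNReal.ofReal c) :
    Integrable f P :=
  ⟨hf, (hasFiniteIntegral_iff_ofReal (.of_forall hf0)).2 (h.trans_lt ENNReal.ofReal_lt_top)⟩

end TailIntegral

section GeometricSum

lemma min_self_inv_le_sub {b y : ℝ} (hb : 1 < b) (hy : 0 < y) :
    min y y⁻¹ ≤ 2 * (1 + b) / (b - 1) * (b * y / (1 + b * y) - y / (1 + y)) := by
  have hb' : 0 < b - 1 := by linarith
  have hden : 0 < (1 + b * y) * (1 + y) := by positivity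
  have hdiff : 2 * (1 + b) / (b - 1) * (b * y / (1 + b * y) - y / (1 + y))
      = 2 * (1 + b) * y / ((1 + b * y) * (1 + y)) := by
    have : 0 < 1 + b * y := by positivity
    field_simp
    ring
  rw [hdiff, le_div_iff₀ hden]
  rcases le_total y 1 with h | h
  · have : (1 + b * y) * (1 + y) ≤ (1 + b) * 2 := by gcongr <;> nlinarith
    calc min y y⁻¹ * ((1 + b * y) * (1 + y)) ≤ y * ((1 + b) * 2) := by
          gcongr; exact min_le_left _ _
      _ = 2 * (1 + b) * y := by ring
  · have : (1 + b * y) * (1 + y) ≤ ((1 + b) * y) * (2 * y) := by gcongr <;> nlinarith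
    calc min y y⁻¹ * ((1 + b * y) * (1 + y)) ≤ y⁻¹ * (((1 + b) * y) * (2 * y)) := by
          gcongr; exact min_le_right _ _
      _ = 2 * (1 + b) * y := by field_simp

-- The increments `min y y⁻¹` are dominated by those of the bounded function `y / (1 + y)`.
lemma sum_min_geometric_le {b x : ℝ} (hb : 1 < b) (hx : 0 < x) (S : ℕ) :
    ∑ s ∈ Finset.range S, min (b ^ s * x) (b ^ s * x)⁻¹ ≤ 2 * (1 + b) / (b - 1) := by
  have : 0 < b - 1 := by linarith
  calc ∑ s ∈ Finset.range S, min (b ^ s * x) (b ^ s * x)⁻¹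
      ≤ ∑ s ∈ Finset.range S, 2 * (1 + b) / (b - 1)
          * (b ^ (s + 1) * x / (1 + b ^ (s + 1) * x) - b ^ s * x / (1 + b ^ s * x)) := by
        refine Finset.sum_le_sum fun s _ => ?_
        rw [pow_succ', mul_assoc b]
        exact min_self_inv_le_sub hb (by positivity)
    _ = 2 * (1 + b) / (b - 1) * (b ^ S * x / (1 + b ^ S * x) - x / (1 + x)) := by
        rw [← Finset.mul_sum, Finset.sum_range_sub fun s => b ^ s * x / (1 + b ^ s * x), pow_zero,
          one_mul]
    _ ≤ 2 * (1 + b) / (b - 1) := by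
        refine mul_le_of_le_one_right (by positivity) ?_
        have : b ^ S * x / (1 + b ^ S * x) ≤ 1 :=
          (div_le_one (by positivity)).2 (by linarith)
        have : 0 ≤ x / (1 + x) := by positivity
        linarith

end GeometricSum

/-! ### The law of the trajectory -/

section PathLaw

variable {K : ℕ}

instance (π : Policy K) (t : ℕ) : IsMarkovKernel (π.kernel t) := π.markov t

instance (F : Environment K) (t : ℕ) : IsMarkovKernel (rewardKernel F t) :=
  ⟨fun k => inferInstanceAs (IsProbabilityMeasure (F t k : Measure ℝ))⟩

lemma measurable_snoc (t : ℕ) : Measurable fun p : History K t × (Fin K × ℝ) =>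
    (Fin.snoc p.1 p.2 : History K (t + 1)) := by
  refine measurable_pi_iff.2 fun i => ?_
  refine Fin.lastCases ?_ (fun j => ?_) i
  · simpa only [Fin.snoc_last] using measurable_snd
  · simp only [Fin.snoc_castSucc]; fun_prop

instance (π : Policy K) (F : Environment K) (t : ℕ) :
    IsProbabilityMeasure (historyLaw π F t) := by
  induction t with
  | zero => unfold historyLaw; infer_instance
  | succ t ih => exact Measure.isProbabilityMeasure_map (measurable_snoc t).aemeasurable

lemma historyLaw_succ_map_init_last (π : Policy K) (F : Environment K) (t : ℕ) :
    (historyLaw π F (t + 1)).map (fun h => ((fun s => h s.castSucc : History K t), h (Fin.last t)))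
      = historyLaw π F t
        ⊗ₘ (π.kernel t ⊗ₖ Kernel.prodMkLeft (History K t) (rewardKernel F t)) := by
  rw [historyLaw, Measure.map_map (by fun_prop) (measurable_snoc t)]
  convert Measure.map_id using 2
  ext p : 1
  simp

/-- The observations made before time `t`. A trajectory is encoded as an infinite sequence, so
that a single probability space carries the histories of all lengths. -/
def past (t : ℕ) (ω : ℕ → Fin K × ℝ) : History K t := fun s => ω s

lemma measurable_past (t : ℕ) : Measurable (past (K := K) t) := by
  unfold past; fun_prop

lemma measurable_arm (t : ℕ) : Measurable fun ω : ℕ → Fin K × ℝ => (ω t).1 :=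
  measurable_fst.comp (measurable_pi_apply t)

lemma measurable_reward (t : ℕ) : Measurable fun ω : ℕ → Fin K × ℝ => (ω t).2 :=
  measurable_snd.comp (measurable_pi_apply t)

/-- `P` is a law of trajectories under which the observations before time `T` are distributed like
the interaction of the policy `π` with the environment `F`. -/
def IsPathLaw (π : Policy K) (F : Environment K) (T : ℕ) (P : Measure (ℕ → Fin K × ℝ)) : Prop :=
  ∀ t ≤ T, P.map (past t) = historyLaw π F t

lemma exists_isPathLaw (hK : 0 < K) (π : Policy K) (F : Environment K) (T : ℕ) :
    ∃ P, IsPathLaw π F T P := by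
  have : Nonempty (Fin K × ℝ) := ⟨⟨0, hK⟩, 0⟩
  let extend : History K T → ℕ → Fin K × ℝ :=
    fun h n => if hn : n < T then h ⟨n, hn⟩ else Classical.arbitrary _
  have hextend : Measurable extend := by
    refine measurable_pi_iff.2 fun n => ?_
    by_cases hn : n < T <;> simp only [extend, hn, dite_true, dite_false] <;> fun_prop
  refine ⟨(historyLaw π F T).map extend, fun t ht => ?_⟩
  induction ht using Nat.decreasingInduction with
  | self =>
    rw [Measure.map_map (measurable_past _) hextend]
    convert Measure.map_id using 2
    ext h s <;> simp [past, extend]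
  | of_succ t _ ih =>
    have hinit : Measurable fun h : History K (t + 1) => (fun s => h s.castSucc : History K t) := by
      fun_prop
    have hcomp : past (K := K) t
        = (fun h : History K (t + 1) => (fun s => h s.castSucc : History K t)) ∘ past (t + 1) := rfl
    rw [hcomp, ← Measure.map_map hinit (measurable_past _), ih,
      ← Measure.fst_compProd (historyLaw π F t)
        (π.kernel t ⊗ₖ Kernel.prodMkLeft (History K t) (rewardKernel F t)),
      ← historyLaw_succ_map_init_last, Measure.fst,
      Measure.map_map measurable_fst (by fun_prop)]
    rfl

variable {π : Policy K} {F : Environment K} {T : ℕ} {P : Measure (ℕ → Fin K × ℝ)}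

namespace IsPathLaw

lemma isProbabilityMeasure (hP : IsPathLaw π F T P) : IsProbabilityMeasure P := by
  have : IsProbabilityMeasure (P.map (past 0)) := by
    rw [hP 0 (Nat.zero_le _)]; infer_instance
  exact (Measure.isProbabilityMeasure_map_iff (measurable_past 0).aemeasurable).1 this

lemma map_past_arm_reward (hP : IsPathLaw π F T P) {t : ℕ} (ht : t < T) :
    P.map (fun ω => ((past t ω, (ω t).1), (ω t).2))
      = historyLaw π F t ⊗ₘ π.kernel t ⊗ₘ Kernel.prodMkLeft (History K t) (rewardKernel F t) := by
  rw [← Measure.compProd_assoc, ← historyLaw_succ_map_init_last, ← hP (t + 1) ht,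
    Measure.map_map (by fun_prop) (measurable_past _),
    Measure.map_map (MeasurableEquiv.measurable _)
      (Measurable.comp (by fun_prop) (measurable_past _))]
  rfl

lemma map_past_arm (hP : IsPathLaw π F T P) {t : ℕ} (ht : t < T) :
    P.map (fun ω => (past t ω, (ω t).1)) = historyLaw π F t ⊗ₘ π.kernel t := by
  rw [← Measure.fst_compProd (historyLaw π F t ⊗ₘ π.kernel t)
      (Kernel.prodMkLeft (History K t) (rewardKernel F t)), ← hP.map_past_arm_reward ht,
    Measure.fst, Measure.map_map measurable_fst
      (((measurable_past t).prodMk (measurable_arm t)).prodMk (measurable_reward t))]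
  rfl

lemma lintegral_mul_le (hP : IsPathLaw π F T P) {t : ℕ} (ht : t < T)
    {f : History K t → ENNReal} (hf : Measurable f) {g : Fin K × ℝ → ENNReal} (hg : Measurable g)
    (hg1 : ∀ k, ∫⁻ x, g (k, x) ∂(F t k : Measure ℝ) ≤ 1) :
    ∫⁻ ω, f (past t ω) * g (ω t) ∂P ≤ ∫⁻ ω, f (past t ω) ∂P := by
  have hfg : Measurable fun p : (History K t × Fin K) × ℝ => f p.1.1 * g (p.1.2, p.2) := by
    fun_prop
  calc ∫⁻ ω, f (past t ω) * g (ω t) ∂P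
      = ∫⁻ q, ∫⁻ x, f q.1 * g (q.2, x) ∂(F t q.2 : Measure ℝ)
          ∂(historyLaw π F t ⊗ₘ π.kernel t) := by
        rw [← lintegral_map hfg
            (((measurable_past t).prodMk (measurable_arm t)).prodMk (measurable_reward t)),
          hP.map_past_arm_reward ht, Measure.lintegral_compProd hfg]
        rfl
    _ ≤ ∫⁻ q, f q.1 ∂(historyLaw π F t ⊗ₘ π.kernel t) := lintegral_mono fun q => by
        rw [lintegral_const_mul _ (by fun_prop)]
        exact mul_le_of_le_one_right' (hg1 q.2)
    _ = ∫⁻ ω, f (past t ω) ∂P := by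
        rw [← hP.map_past_arm ht, lintegral_map (by fun_prop)
          ((measurable_past t).prodMk (measurable_arm t))]

lemma integrable_reward (hP : IsPathLaw π F T P) (hF : HeavyTailed F T) {t : ℕ} (ht : t < T) :
    Integrable (fun ω => (ω t).2) P := by
  have := hP.isProbabilityMeasure
  have hsq : ∫⁻ ω, ENNReal.ofReal ((ω t).2 ^ 2) ∂P ≤ 1 := by
    simpa using hP.lintegral_mul_le ht (f := fun _ => 1) measurable_const
      (g := fun p => ENNReal.ofReal (p.2 ^ 2)) (by fun_prop) (hF t ht)
  exact (memLp_two_of_lintegral_sq_lt_top (measurable_reward t).aestronglyMeasurable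
    (hsq.trans_lt ENNReal.one_lt_top)).integrable one_le_two

lemma integral_reward (hP : IsPathLaw π F T P) (hF : HeavyTailed F T) {t : ℕ} (ht : t < T) :
    ∫ ω, (ω t).2 ∂P = ∫ ω, mean F t (ω t).1 ∂P := by
  have hmap : Measurable fun ω : ℕ → Fin K × ℝ => ((past t ω, (ω t).1), (ω t).2) :=
    ((measurable_past t).prodMk (measurable_arm t)).prodMk (measurable_reward t)
  have hmean : Measurable fun q : History K t × Fin K => mean F t q.2 :=
    (Measurable.of_discrete (f := mean F t)).comp measurable_snd
  have hint : Integrable (fun p : (History K t × Fin K) × ℝ => p.2)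
      (historyLaw π F t ⊗ₘ π.kernel t ⊗ₘ Kernel.prodMkLeft (History K t) (rewardKernel F t)) := by
    rw [← hP.map_past_arm_reward ht]
    exact (integrable_map_measure measurable_snd.aestronglyMeasurable hmap.aemeasurable).2
      (hP.integrable_reward hF ht)
  calc ∫ ω, (ω t).2 ∂P
      = ∫ q, mean F t q.2 ∂(historyLaw π F t ⊗ₘ π.kernel t) := by
        rw [← integral_map hmap.aemeasurable measurable_snd.aestronglyMeasurable,
          hP.map_past_arm_reward ht, Measure.integral_compProd hint]
        rfl
    _ = ∫ ω, mean F t (ω t).1 ∂P := by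
        rw [← hP.map_past_arm ht, integral_map
          ((measurable_past t).prodMk (measurable_arm t)).aemeasurable hmean.aestronglyMeasurable]

end IsPathLaw

lemma integrable_comp_arm [IsFiniteMeasure P] (f : Fin K → ℝ) (t : ℕ) :
    Integrable (fun ω => f (ω t).1) P :=
  .of_bound (Measurable.of_discrete.comp (measurable_arm t)).aestronglyMeasurable (∑ k, |f k|)
    (.of_forall fun _ => Finset.single_le_sum (f := fun k => |f k|) (fun _ _ => abs_nonneg _)
      (Finset.mem_univ _))

/-- The loss in expected reward at time `t`, compared with the best arm. -/
def gap (F : Environment K) (t : ℕ) (ω : ℕ → Fin K × ℝ) : ℝ := bestMean F t - mean F t (ω t).1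

lemma integrable_gap [IsFiniteMeasure P] (t : ℕ) : Integrable (gap F t) P :=
  (integrable_const _).sub (integrable_comp_arm (mean F t) t)

lemma IsPathLaw.regret_eq (hP : IsPathLaw π F T P) (hF : HeavyTailed F T) :
    regret π F T = ∫ ω, ∑ t ∈ Finset.range T, gap F t ω ∂P := by
  have := hP.isProbabilityMeasure
  have hreward : ∫ h, ∑ t : Fin T, (h t).2 ∂(historyLaw π F T)
      = ∑ t ∈ Finset.range T, ∫ ω, mean F t (ω t).1 ∂P := by
    rw [← hP T le_rfl, integral_map (measurable_past T).aemeasurable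
      (by fun_prop : Measurable fun h : History K T => ∑ t : Fin T, (h t).2).aestronglyMeasurable]
    have hsum : ∀ ω : ℕ → Fin K × ℝ, ∑ t : Fin T, (past T ω t).2 = ∑ t ∈ Finset.range T, (ω t).2 :=
      fun ω => Fin.sum_univ_eq_sum_range (fun t => (ω t).2) T
    simp_rw [hsum]
    rw [integral_finsetSum _ fun t ht => hP.integrable_reward hF (Finset.mem_range.1 ht)]
    exact Finset.sum_congr rfl fun t ht => hP.integral_reward hF (Finset.mem_range.1 ht)
  rw [regret, hreward, integral_finsetSum _ fun t _ => integrable_gap t,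
    ← Finset.sum_sub_distrib]
  refine Finset.sum_congr rfl fun t _ => ?_
  simp only [gap]
  rw [integral_sub (integrable_const _) (integrable_comp_arm _ t)]
  simp

/-! ### Admissibility along the trajectory -/

lemma measurableSet_pull {t : ℕ} (τ : ℕ) (k : Fin K) (s : Fin t) :
    MeasurableSet {h : History K t | (s : ℕ) / τ = t / τ ∧ (h s).1 = k} :=
  (MeasurableSet.const _).inter
    ((measurable_fst.comp (measurable_pi_apply s)) (measurableSet_singleton k))

lemma measurable_card_pulls {t : ℕ} (τ : ℕ) (k : Fin K) :
    Measurable fun h : History K t => (pulls τ h k).card := by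
  simp only [pulls, Finset.card_filter]
  exact Finset.measurable_sum _ fun s _ =>
    .ite (measurableSet_pull τ k s) measurable_const measurable_const

lemma measurable_sum_pulls_sat {t : ℕ} (a : ℝ) (τ : ℕ) (k : Fin K) :
    Measurable fun h : History K t =>
      ∑ s ∈ pulls τ h k, sat (h s).2 (satLimit a τ K (pulls τ h k).card) := by
  have hfilter : ∀ h : History K t,
      ∑ s ∈ pulls τ h k, sat (h s).2 (satLimit a τ K (pulls τ h k).card)
        = ∑ s : Fin t, if (s : ℕ) / τ = t / τ ∧ (h s).1 = k then
          sat (h s).2 (satLimit a τ K (pulls τ h k).card) else 0 := fun h =>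
    Finset.sum_filter (fun s : Fin t => (s : ℕ) / τ = t / τ ∧ (h s).1 = k) _
  simp_rw [hfilter]
  refine Finset.measurable_sum _ fun s _ => .ite (measurableSet_pull τ k s) ?_ measurable_const
  exact measurable_sat.comp ((measurable_snd.comp (measurable_pi_apply s)).prodMk
    ((Measurable.of_discrete (f := satLimit a τ K)).comp (measurable_card_pulls τ k)))

lemma measurable_ucb {t : ℕ} (a ζ : ℝ) (τ : ℕ) (k : Fin K) :
    Measurable fun h : History K t => ucb a ζ τ h k := by
  have hcard := measurable_card_pulls (t := t) τ k
  exact ((measurable_sum_pulls_sat a τ k).div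
    ((Measurable.of_discrete (f := ((↑) : ℕ → ℝ))).comp hcard)).add
    (((Measurable.of_discrete (f := confWidth τ K)).comp hcard).const_mul _)

lemma measurableSet_admissible {t : ℕ} (a ζ : ℝ) (τ : ℕ) :
    MeasurableSet {q : History K t × Fin K | Admissible a ζ τ q.1 q.2} := by
  have hempty : ∀ j : Fin K, Measurable fun h : History K t => pulls τ h j = ∅ := fun j => by
    simp only [← Finset.card_eq_zero]
    exact measurableSet_setOfPred.1 (measurable_card_pulls τ j (measurableSet_singleton 0))
  refine measurableSet_setOfPred.2 (measurable_from_prod_countable_left fun k => ?_)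
  exact (hempty k).or ((Measurable.forall fun j => (hempty j).not).and
    (Measurable.forall fun j => measurableSet_setOfPred.1
      (measurableSet_le (measurable_ucb a ζ τ j) (measurable_ucb a ζ τ k))))

lemma IsPathLaw.ae_admissible (hP : IsPathLaw π F T P) {a ζ : ℝ} {τ : ℕ}
    (hπ : IsRRMOSS a ζ τ π) :
    ∀ᵐ ω ∂P, ∀ t < T, Admissible a ζ τ (past t ω) (ω t).1 := by
  refine ae_all_iff.2 fun t => ?_
  by_cases ht : t < T
  swap
  · simp [ht]
  have hmap : ∀ᵐ q ∂(P.map fun ω => (past t ω, (ω t).1)), Admissible a ζ τ q.1 q.2 := by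
    rw [hP.map_past_arm ht, Measure.ae_compProd_iff (measurableSet_admissible a ζ τ)]
    exact .of_forall (hπ t)
  filter_upwards [ae_of_ae_map ((measurable_past t).prodMk (measurable_arm t)).aemeasurable hmap]
    with ω hω _
  exact hω

end PathLaw

/-! ### Confidence widths and saturation limits -/

lemma one_le_lnPlus (x : ℝ) : 1 ≤ lnPlus x := le_max_right _ _

lemma lnPlus_pos (x : ℝ) : 0 < lnPlus x := zero_lt_one.trans_le (one_le_lnPlus x)

lemma lnPlus_mono {x y : ℝ} (hx : 0 < x) (h : x ≤ y) : lnPlus x ≤ lnPlus y :=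
  max_le_max_right _ (Real.log_le_log hx h)

lemma exp_neg_lnPlus_le_one (x : ℝ) : Real.exp (-lnPlus x) ≤ 1 :=
  Real.exp_le_one_iff.2 (neg_nonpos.2 (lnPlus_pos x).le)

lemma exp_neg_lnPlus_le_inv {x : ℝ} (hx : 0 < x) : Real.exp (-lnPlus x) ≤ x⁻¹ := by
  calc Real.exp (-lnPlus x) ≤ Real.exp (-Real.log x) :=
        Real.exp_le_exp.2 (neg_le_neg (le_max_left _ _))
    _ = x⁻¹ := by rw [Real.exp_neg, Real.exp_log hx]

lemma lnPlus_le_one_add_sqrt {x : ℝ} (hx : 0 < x) : lnPlus x ≤ 1 + √x := by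
  refine max_le ?_ (by linarith [Real.sqrt_nonneg x])
  have hlog : Real.log x = 2 * (Real.log (√x / 2) + Real.log 2) := by
    rw [Real.log_div (by positivity) two_ne_zero, Real.log_sqrt hx.le]; ring
  have hhalf := Real.log_le_sub_one_of_pos (x := √x / 2) (by positivity)
  linarith [Real.log_two_lt_d9]

lemma gridUp_pos {a : ℝ} (ha : 0 < a) (m : ℕ) : 0 < gridUp a m := zpow_pos ha _

lemma le_gridUp {a : ℝ} (ha : 1 < a) {m : ℕ} (hm : 0 < m) : (m : ℝ) ≤ gridUp a m := by
  have h := (Int.lt_floor_add_one (Real.logb a m)).le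
  rw [Real.logb_le_iff_le_rpow ha (Nat.cast_pos.2 hm)] at h
  exact_mod_cast h

lemma gridUp_le {a : ℝ} (ha : 1 < a) {m : ℕ} (hm : 0 < m) : gridUp a m ≤ a * m := by
  have h := Int.floor_le (Real.logb a m)
  rw [Real.le_logb_iff_rpow_le ha (Nat.cast_pos.2 hm)] at h
  rw [gridUp, zpow_add₀ (by linarith), zpow_one, mul_comm]
  gcongr
  exact_mod_cast h

lemma exists_gridUp_eq_pow {a : ℝ} (ha : 1 < a) {m N : ℕ} (hm : 0 < m) (hmN : m ≤ N) :
    ∃ s ∈ Finset.range (⌊Real.logb a N⌋₊ + 1), gridUp a m = a ^ (s + 1) := by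
  refine ⟨⌊Real.logb a m⌋₊, ?_, ?_⟩
  · rw [Finset.mem_range, Nat.lt_succ_iff]
    exact Nat.floor_mono (Real.logb_le_logb_of_le ha (Nat.cast_pos.2 hm) (Nat.cast_le.2 hmN))
  · rw [gridUp, ← Int.natCast_floor_eq_floor (Real.logb_nonneg ha (Nat.one_le_cast.2 hm))]
    exact_mod_cast rfl

/-- The saturation limit as a function of the grid point: `satLimit a τ K m` is
`gridLimit τ K (gridUp a m)`. -/
def gridLimit (τ K : ℕ) (H : ℝ) : ℝ := √(H / lnPlus (τ / (K * H)))

lemma gridLimit_pos (τ K : ℕ) {H : ℝ} (hH : 0 < H) : 0 < gridLimit τ K H :=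
  Real.sqrt_pos.2 (div_pos hH (lnPlus_pos _))

lemma sq_gridLimit (τ K : ℕ) {H : ℝ} (hH : 0 < H) :
    gridLimit τ K H ^ 2 = H / lnPlus (τ / (K * H)) :=
  Real.sq_sqrt (div_pos hH (lnPlus_pos _)).le

lemma sq_confWidth (τ K m : ℕ) : confWidth τ K m ^ 2 = lnPlus (τ / (K * m)) / m :=
  Real.sq_sqrt (div_nonneg (lnPlus_pos _).le (Nat.cast_nonneg m))

lemma inv_gridLimit_le_confWidth {τ K m : ℕ} (hτ : 0 < τ) (hK : 0 < K) (hm : 0 < m) {H : ℝ}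
    (h : (m : ℝ) ≤ H) : 1 / gridLimit τ K H ≤ confWidth τ K m := by
  have hm' : (0 : ℝ) < m := Nat.cast_pos.2 hm
  have hH : 0 < H := hm'.trans_le h
  have hln : lnPlus (τ / (K * H)) ≤ lnPlus (τ / (K * m)) :=
    lnPlus_mono (by positivity) (by gcongr)
  rw [gridLimit, confWidth, one_div, ← Real.sqrt_inv, inv_div]
  exact Real.sqrt_le_sqrt (div_le_div₀ (lnPlus_pos _).le hln hm' h)

/-! ### The critical gap -/

/-- The gap below which an arm may be selected throughout an epoch of `τ` slots without harming
the rate of the regret. -/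
def criticalGap (τ K : ℕ) : ℝ := √((K : ℝ) / τ)

lemma sq_criticalGap (τ K : ℕ) : criticalGap τ K ^ 2 = (K : ℝ) / τ := Real.sq_sqrt (by positivity)

section CriticalGap

variable {τ K : ℕ}

lemma criticalGap_pos (hτ : 0 < τ) (hK : 0 < K) : 0 < criticalGap τ K :=
  Real.sqrt_pos.2 (by positivity)

lemma div_criticalGap (hτ : 0 < τ) (hK : 0 < K) : K / criticalGap τ K = τ * criticalGap τ K := by
  rw [div_eq_iff (criticalGap_pos hτ hK).ne', mul_assoc, ← sq, sq_criticalGap]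
  field_simp

lemma exp_neg_lnPlus_div_le (hτ : 0 < τ) (hK : 0 < K) {c H : ℝ} (hc : 0 < c) (hH : 0 < H) :
    Real.exp (-lnPlus (τ / (K * H))) / (c * √H) ≤
      criticalGap τ K / c * min (√H * criticalGap τ K) (√H * criticalGap τ K)⁻¹ := by
  have hδ := criticalGap_pos hτ hK
  rw [div_le_iff₀ (by positivity), mul_min_of_nonneg _ _ (by positivity),
    min_mul_of_nonneg _ _ (by positivity), le_min_iff]
  constructor
  · refine (exp_neg_lnPlus_le_inv (by positivity)).trans (le_of_eq ?_)
    calc ((τ : ℝ) / (K * H))⁻¹ = criticalGap τ K ^ 2 * √H ^ 2 := by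
          rw [sq_criticalGap, Real.sq_sqrt hH.le, inv_div, div_mul_eq_mul_div]
      _ = criticalGap τ K / c * (√H * criticalGap τ K) * (c * √H) := by field_simp
  · refine (exp_neg_lnPlus_le_one _).trans (le_of_eq ?_)
    field_simp

lemma lnPlus_le_one_add_inv_criticalGap (hτ : 0 < τ) (hK : 0 < K) {m : ℕ} (hm : 0 < m) :
    lnPlus (τ / (K * m)) ≤ 1 + (criticalGap τ K * √m)⁻¹ := by
  have hsqrt : √((τ : ℝ) / (K * m)) = (criticalGap τ K * √m)⁻¹ := by
    rw [criticalGap, ← Real.sqrt_mul (by positivity), ← Real.sqrt_inv]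
    congr 1
    field_simp
  exact hsqrt ▸ lnPlus_le_one_add_sqrt (by positivity)

lemma mul_confWidth_le (hτ : 0 < τ) (hK : 0 < K) {D Δ : ℝ} (hD : 1 ≤ D)
    (hΔ : criticalGap τ K ≤ Δ) {m : ℕ} (hm : 2 * D ^ 2 / (criticalGap τ K * Δ) ≤ m) :
    D * confWidth τ K m ≤ Δ := by
  set δ := criticalGap τ K
  have hδ : 0 < δ := criticalGap_pos hτ hK
  have hΔ0 : 0 < Δ := hδ.trans_le hΔ
  have hm0 : (0 : ℝ) < m := lt_of_lt_of_le (by positivity) hm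
  have hs2 : √(m : ℝ) ^ 2 = m := Real.sq_sqrt hm0.le
  rw [div_le_iff₀ (by positivity)] at hm
  have hmΔ : 2 * D ^ 2 ≤ m * Δ ^ 2 := hm.trans (by rw [sq Δ]; gcongr)
  have hsΔ : 1 ≤ √(m : ℝ) * Δ := by
    refine (one_le_sq_iff₀ (by positivity)).1 ?_
    rw [mul_pow, hs2]
    nlinarith
  have htail : D ^ 2 * (δ * √m)⁻¹ ≤ m * Δ ^ 2 / 2 := by
    rw [← div_eq_mul_inv, div_le_iff₀ (by positivity)]
    have := mul_le_mul hm hsΔ zero_le_one (by positivity)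
    linarith
  have hln : D ^ 2 * lnPlus (τ / (K * m)) ≤ m * Δ ^ 2 := by
    have := mul_le_mul_of_nonneg_left
      (lnPlus_le_one_add_inv_criticalGap hτ hK (Nat.cast_pos.1 hm0)) (sq_nonneg D)
    linarith
  refine le_of_sq_le_sq ?_ hΔ0.le
  rwa [mul_pow, sq_confWidth, mul_div_assoc', div_le_iff₀ hm0, mul_comm (Δ ^ 2)]

/-- The number of selections after which the confidence width of an arm is small compared with its
gap `Δ`. -/
def burnIn (ζ : ℝ) (τ K : ℕ) (Δ : ℝ) : ℕ := ⌈2 * (12 * (1 + ζ)) ^ 2 / (criticalGap τ K * Δ)⌉₊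

lemma confWidth_le_of_burnIn_le (hτ : 0 < τ) (hK : 0 < K) {ζ Δ : ℝ} (hζ : 0 < ζ)
    (hΔ : criticalGap τ K ≤ Δ) {m : ℕ} (hm : burnIn ζ τ K Δ ≤ m) :
    (2 + 2 * ζ) * confWidth τ K m ≤ Δ / 6 := by
  have h := mul_confWidth_le hτ hK (D := 12 * (1 + ζ)) (by linarith) hΔ
    ((Nat.le_ceil _).trans (Nat.cast_le.2 hm))
  linarith

end CriticalGap

/-! ### Deviations of the saturated sums -/

/-- The slots `s < t` of epoch `e` in which arm `k` was selected. -/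
def armSlots {K : ℕ} (τ e : ℕ) (k : Fin K) (t : ℕ) (ω : ℕ → Fin K × ℝ) : Finset ℕ :=
  {s ∈ Finset.range t | s / τ = e ∧ (ω s).1 = k}

/-- The centred sum of the rewards of arm `k` in epoch `e`, saturated at level `B`. -/
def deviation {K : ℕ} (F : Environment K) (τ e : ℕ) (k : Fin K) (B : ℝ) (t : ℕ)
    (ω : ℕ → Fin K × ℝ) : ℝ :=
  ∑ s ∈ armSlots τ e k t ω, (sat (ω s).2 B - ∫ x, sat x B ∂(F s k : Measure ℝ))

/-- The amount by which the mean deviation of arm `k`, taken with the sign `ε = ± 1`, exceeds `ζ`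
times the confidence width. It is `0` before the first selection, as then `x / 0 = 0`. -/
def excess {K : ℕ} (F : Environment K) (a ζ : ℝ) (τ e : ℕ) (k : Fin K) (ε : ℝ) (t : ℕ)
    (ω : ℕ → Fin K × ℝ) : ℝ :=
  ε * deviation F τ e k (satLimit a τ K (armSlots τ e k t ω).card) t ω / (armSlots τ e k t ω).card
    - ζ * confWidth τ K (armSlots τ e k t ω).card

/-- The rate of the exponential tail of `excess`. -/
def devRate (a ζ : ℝ) : ℝ := Real.log (1 + 2 * ζ / a) / (2 * a)

lemma devRate_pos {a ζ : ℝ} (ha : 0 < a) (hζ : 0 < ζ) : 0 < devRate a ζ :=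
  div_pos (Real.log_pos (lt_add_of_pos_right 1 (by positivity))) (by linarith)

section Deviation

variable {K : ℕ} {π : Policy K} {F : Environment K} {T : ℕ} {P : Measure (ℕ → Fin K × ℝ)}

lemma card_armSlots_le (τ e : ℕ) (k : Fin K) (t : ℕ) (ω : ℕ → Fin K × ℝ) :
    (armSlots τ e k t ω).card ≤ t :=
  (Finset.card_filter_le _ _).trans (Finset.card_range t).le

lemma measurableSet_selected (τ e s : ℕ) (k : Fin K) :
    MeasurableSet {ω : ℕ → Fin K × ℝ | s / τ = e ∧ (ω s).1 = k} :=
  (MeasurableSet.const _).inter (measurable_arm s (measurableSet_singleton k))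

lemma measurable_card_armSlots (τ e : ℕ) (k : Fin K) (t : ℕ) :
    Measurable fun ω => (armSlots τ e k t ω).card := by
  simp only [armSlots, Finset.card_filter]
  exact Finset.measurable_sum _ fun s _ =>
    .ite (measurableSet_selected τ e s k) measurable_const measurable_const

lemma measurable_deviation (F : Environment K) (τ e : ℕ) (k : Fin K) (B : ℝ) (t : ℕ) :
    Measurable (deviation F τ e k B t) := by
  unfold deviation
  simp only [armSlots, Finset.sum_filter]
  exact Finset.measurable_sum _ fun s _ =>
    .ite (measurableSet_selected τ e s k)
      (((measurable_sat_left B).comp (measurable_reward s)).sub_const _) measurable_const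

lemma measurable_excess (F : Environment K) (a ζ : ℝ) (τ e : ℕ) (k : Fin K) (ε : ℝ) (t : ℕ) :
    Measurable (excess F a ζ τ e k ε t) := by
  have hcard := measurable_card_armSlots τ e k t
  have hjoint : Measurable (Function.uncurry fun n : ℕ => deviation F τ e k (satLimit a τ K n) t) :=
    measurable_from_prod_countable_right fun n => measurable_deviation F τ e k (satLimit a τ K n) t
  have hdev : Measurable fun ω =>
      deviation F τ e k (satLimit a τ K (armSlots τ e k t ω).card) t ω :=
    hjoint.comp (hcard.prodMk measurable_id)
  have hcast : Measurable fun ω => ((armSlots τ e k t ω).card : ℝ) :=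
    (Measurable.of_discrete (f := fun n : ℕ => (n : ℝ))).comp hcard
  exact ((hdev.const_mul ε).div hcast).sub
    (((Measurable.of_discrete (f := confWidth τ K)).comp hcard).const_mul ζ)

namespace IsPathLaw

lemma mul_measure_exists_le_prod_le_one (hP : IsPathLaw π F T P)
    {g : ℕ → Fin K × ℝ → ENNReal} (hg : ∀ s, Measurable (g s))
    (hg1 : ∀ t < T, ∀ k, ∫⁻ x, g t (k, x) ∂(F t k : Measure ℝ) ≤ 1) (c : ENNReal) :
    c * P {ω | ∃ t ≤ T, c ≤ ∏ s ∈ Finset.range t, g s (ω s)} ≤ 1 := by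
  have := hP.isProbabilityMeasure
  have hM : ∀ t, Measurable fun ω : ℕ → Fin K × ℝ => ∏ s ∈ Finset.range t, g s (ω s) :=
    fun t => Finset.measurable_fun_prod _ fun s _ => (hg s).comp (measurable_pi_apply s)
  refine (mul_measure_exists_le_le_lintegral hM fun t ht => ?_).trans (by simp)
  let prodPast : ℕ → History K t → ENNReal := fun s h =>
    ∏ r : Fin t, if (r : ℕ) < s then g r (h r) else 1
  have hprodPast : ∀ s ≤ t, ∀ ω, prodPast s (past t ω) = ∏ r ∈ Finset.range s, g r (ω r) := by
    intro s hs ω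
    refine (Fin.prod_univ_eq_prod_range (fun r => if r < s then g r (ω r) else 1) t).trans ?_
    rw [← Finset.prod_filter]
    congr 1
    ext r
    simp only [Finset.mem_filter, Finset.mem_range]
    omega
  have hmeas : ∀ s, Measurable (prodPast s) := fun s =>
    Finset.measurable_fun_prod _ fun r _ => by
      split_ifs
      exacts [(hg r).comp (measurable_pi_apply r), measurable_const]
  have hset : MeasurableSet {h | ∀ s ≤ t, prodPast s h < c} := by
    simp only [Set.ofPred_forall]
    exact .iInter fun s => .iInter fun _ => measurableSet_lt (hmeas s) measurable_const
  have hN : {ω | ∀ s ≤ t, ∏ r ∈ Finset.range s, g r (ω r) < c}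
      = past t ⁻¹' {h | ∀ s ≤ t, prodPast s h < c} := by
    ext ω
    exact forall₂_congr fun s hs => by rw [hprodPast s hs]
  have hstep := hP.lintegral_mul_le ht ((hmeas t).indicator hset) (hg t) (hg1 t ht)
  rw [hN, ← lintegral_indicator (measurable_past t hset),
    ← lintegral_indicator (measurable_past t hset)]
  convert hstep using 3 with ω ω <;>
    by_cases hω : ∀ s ≤ t, prodPast s (past t ω) < c <;>
      simp [Set.indicator, hω, hprodPast t le_rfl, Finset.prod_range_succ]

lemma measure_exists_le_deviation (hP : IsPathLaw π F T P) (hF : HeavyTailed F T) (τ e : ℕ)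
    (k : Fin K) {B b η : ℝ} (hB : 0 ≤ B) (hη : |η| * (2 * B) ≤ b) (θ : ℝ) :
    P {ω | ∃ t ≤ T, θ ≤ η * deviation F τ e k B t ω
      - η ^ 2 * bennett b * (armSlots τ e k t ω).card} ≤ ENNReal.ofReal (Real.exp (-θ)) := by
  let inc : ℕ → Fin K × ℝ → ℝ := fun s p => if s / τ = e ∧ p.1 = k then
    η * (sat p.2 B - ∫ y, sat y B ∂(F s k : Measure ℝ)) - η ^ 2 * bennett b else 0
  have hinc : ∀ s, Measurable (inc s) := fun s => .ite
    ((MeasurableSet.const _).inter (measurable_fst (measurableSet_singleton k)))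
    (((((measurable_sat_left B).comp measurable_snd).sub_const _).const_mul _).sub_const _)
    measurable_const
  have hinc1 : ∀ t < T, ∀ j,
      ∫⁻ x, ENNReal.ofReal (Real.exp (inc t (j, x))) ∂(F t j : Measure ℝ) ≤ 1 := by
    intro t ht j
    by_cases h : t / τ = e ∧ j = k
    · obtain ⟨h, rfl⟩ := h
      simp only [inc, h, and_self, if_true]
      exact lintegral_exp_sat_sub_le_one (hF.memLp ht j) (hF.integral_sq_le_one ht j) hB hη
    · simp [inc, h]
  have hprod : ∀ t ω, ∏ s ∈ Finset.range t, ENNReal.ofReal (Real.exp (inc s (ω s)))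
      = ENNReal.ofReal (Real.exp (η * deviation F τ e k B t ω
        - η ^ 2 * bennett b * (armSlots τ e k t ω).card)) := by
    intro t ω
    rw [← ENNReal.ofReal_prod_of_nonneg fun _ _ => (Real.exp_pos _).le, ← Real.exp_sum]
    simp only [inc, deviation, armSlots]
    rw [← Finset.sum_filter, Finset.sum_sub_distrib, Finset.mul_sum, Finset.sum_const,
      nsmul_eq_mul, mul_comm (Finset.card _ : ℝ)]
  have hville := hP.mul_measure_exists_le_prod_le_one
    (fun s => (Real.measurable_exp.comp (hinc s)).ennreal_ofReal) hinc1
    (ENNReal.ofReal (Real.exp θ))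
  simp only [Function.comp_apply, hprod, ENNReal.ofReal_le_ofReal_iff (Real.exp_pos _).le,
    Real.exp_le_exp] at hville
  rw [Real.exp_neg, ENNReal.ofReal_inv_of_pos (Real.exp_pos θ)]
  exact ENNReal.le_inv_iff_mul_le.2 (mul_comm _ (P _) ▸ hville)

end IsPathLaw

lemma four_le_of_psi_ge {a ζ : ℝ} (ha : 0 < a) (hζ : 0 < ζ)
    (hψ : psi (2 * ζ / a) ≥ 2 * a / ζ) :
    4 ≤ (1 + 2 * ζ / a) * Real.log (1 + 2 * ζ / a) - 2 * ζ / a := by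
  have hu : 0 < 2 * ζ / a := by positivity
  calc (4 : ℝ) = 2 * a / ζ * (2 * ζ / a) := by field_simp; norm_num
    _ ≤ psi (2 * ζ / a) * (2 * ζ / a) := by gcongr
    _ = _ := by
      generalize 2 * ζ / a = u at hu ⊢
      rw [psi]
      field_simp
      ring

-- With `ℓ = log (1 + 2 * ζ / a)` and `η = ℓ / (2 * B)`, the condition on `ψ` makes the exponent of
-- the supermartingale at least `H / B ^ 2`, and the slack `x` contributes the linear term.
lemma deviation_exponent {a ζ : ℝ} (ha : 0 < a) (hζ : 0 < ζ) (hψ : psi (2 * ζ / a) ≥ 2 * a / ζ)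
    {H B n x D : ℝ} (hB : 0 < B) (hBH : B ^ 2 ≤ H) (hn : n ≤ H) (hHn : H ≤ a * n) (hx : 0 ≤ x)
    (hD : n * (ζ / B + x) ≤ D) :
    H / B ^ 2 + devRate a ζ * √H * x ≤ Real.log (1 + 2 * ζ / a) / (2 * B) * D
      - (2 * ζ / a - Real.log (1 + 2 * ζ / a)) / (4 * B ^ 2) * n := by
  have h4 := four_le_of_psi_ge ha hζ hψ
  have hu0 : 0 < 2 * ζ / a := by positivity
  have hdev : devRate a ζ = Real.log (1 + 2 * ζ / a) / (2 * a) := rfl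
  have hℓ0 : 0 < Real.log (1 + 2 * ζ / a) := Real.log_pos (by linarith)
  have hℓu : Real.log (1 + 2 * ζ / a) ≤ 2 * ζ / a := by
    linarith [Real.log_le_sub_one_of_pos (x := 1 + 2 * ζ / a) (by linarith)]
  set u := 2 * ζ / a with hu
  set ℓ := Real.log (1 + u)
  have hH : 0 < H := (by positivity : 0 < B ^ 2).trans_le hBH
  have hHB : √H ≤ H / B := by
    rw [le_div_iff₀ hB]
    calc √H * B ≤ √H * √H := by gcongr; exact Real.le_sqrt_of_sq_le hBH
      _ = H := Real.mul_self_sqrt hH.le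
  have hslack : devRate a ζ * √H * x ≤ ℓ / (2 * a) * (H / B) * x := by
    rw [hdev]; gcongr
  have hlinear : ℓ * u / 4 * (H / B ^ 2) + ℓ / (2 * a) * (H / B) * x ≤ ℓ / (2 * B) * D := by
    calc _ = ℓ / (2 * B) * (H / a * (ζ / B + x)) := by rw [hu]; field_simp; ring
      _ ≤ ℓ / (2 * B) * (n * (ζ / B + x)) := by
        gcongr
        exact (div_le_iff₀' ha).2 hHn
      _ ≤ ℓ / (2 * B) * D := by gcongr
  have hvariance : (u - ℓ) / (4 * B ^ 2) * n ≤ (u - ℓ) / 4 * (H / B ^ 2) := by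
    calc _ ≤ (u - ℓ) / (4 * B ^ 2) * H :=
        mul_le_mul_of_nonneg_left hn (div_nonneg (sub_nonneg.2 hℓu) (by positivity))
      _ = _ := by field_simp
  have hmain : 1 * (H / B ^ 2) ≤ (ℓ * u / 4 - (u - ℓ) / 4) * (H / B ^ 2) := by
    gcongr; linarith
  linarith

lemma deviation_exponent_of_le_excess {a ζ : ℝ} (ha : 1 < a) (hζ : 0 < ζ)
    (hψ : psi (2 * ζ / a) ≥ 2 * a / ζ) {τ : ℕ} (hτ : 0 < τ) {e : ℕ} {k : Fin K} {ε : ℝ}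
    {x : ℝ} (hx : 0 ≤ x) {t : ℕ} {ω : ℕ → Fin K × ℝ} (hn : 0 < (armSlots τ e k t ω).card)
    {H : ℝ} (hnH : gridUp a (armSlots τ e k t ω).card = H)
    (hxe : x ≤ excess F a ζ τ e k ε t ω) :
    lnPlus (τ / (K * H)) + devRate a ζ * √H * x ≤
      Real.log (1 + 2 * ζ / a) / (2 * gridLimit τ K H)
          * (ε * deviation F τ e k (gridLimit τ K H) t ω)
        - (2 * ζ / a - Real.log (1 + 2 * ζ / a)) / (4 * gridLimit τ K H ^ 2)
          * (armSlots τ e k t ω).card := by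
  have ha0 : 0 < a := zero_lt_one.trans ha
  have hH : 0 < H := hnH ▸ gridUp_pos ha0 _
  have hB := gridLimit_pos τ K hH
  have hnle := hnH ▸ le_gridUp ha hn
  have hD : (armSlots τ e k t ω).card * (ζ / gridLimit τ K H + x) ≤
      ε * deviation F τ e k (gridLimit τ K H) t ω := by
    have hwidth := mul_le_mul_of_nonneg_left
      (inv_gridLimit_le_confWidth hτ (Fin.pos k) hn hnle) hζ.le
    rw [excess, satLimit, hnH] at hxe
    change x ≤ ε * deviation F τ e k (gridLimit τ K H) t ω / _ - _ at hxe
    rw [← le_div_iff₀' (Nat.cast_pos.2 hn)]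
    rw [mul_one_div] at hwidth
    linarith
  have hexp := deviation_exponent ha0 hζ hψ hB
    (by rw [sq_gridLimit τ K hH]; exact div_le_self hH.le (one_le_lnPlus _))
    hnle (hnH ▸ gridUp_le ha hn) hx hD
  rwa [sq_gridLimit τ K hH, div_div_cancel₀ hH.ne', ← sq_gridLimit τ K hH] at hexp

lemma IsPathLaw.measure_exists_le_excess (hP : IsPathLaw π F T P) (hF : HeavyTailed F T)
    {a ζ : ℝ} (ha : 1 < a) (hζ : 0 < ζ) (hψ : psi (2 * ζ / a) ≥ 2 * a / ζ) {τ : ℕ} (hτ : 0 < τ)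
    (e : ℕ) (k : Fin K) {ε : ℝ} (hε : |ε| = 1) {H : ℝ} (hH : 0 < H) {x : ℝ} (hx : 0 ≤ x) :
    P {ω | ∃ t ≤ T, 0 < (armSlots τ e k t ω).card ∧ gridUp a (armSlots τ e k t ω).card = H ∧
      x ≤ excess F a ζ τ e k ε t ω} ≤
    ENNReal.ofReal (Real.exp (-lnPlus (τ / (K * H))) * Real.exp (-(devRate a ζ * √H * x))) := by
  set ℓ := Real.log (1 + 2 * ζ / a) with hℓ
  set B := gridLimit τ K H
  have hu0 : 0 < 2 * ζ / a := div_pos (by linarith) (by linarith)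
  have hB : 0 < B := gridLimit_pos τ K hH
  have hℓ0 : 0 < ℓ := Real.log_pos (by linarith)
  have hη : |ε * (ℓ / (2 * B))| * (2 * B) ≤ ℓ := by
    rw [abs_mul, hε, one_mul, abs_of_pos (by positivity), div_mul_cancel₀ _ (by positivity)]
  have hbennett : (ε * (ℓ / (2 * B))) ^ 2 * bennett ℓ = (2 * ζ / a - ℓ) / (4 * B ^ 2) := by
    rw [mul_pow, ← sq_abs ε, hε, bennett, hℓ, Real.exp_log (by linarith), ← hℓ]
    field_simp
    ring
  rw [← Real.exp_add, ← neg_add]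
  refine (measure_mono ?_).trans (hP.measure_exists_le_deviation hF τ e k hB.le hη _)
  rintro ω ⟨t, ht, hn, hnH, hxe⟩
  refine ⟨t, ht, ?_⟩
  rw [hbennett, mul_comm ε, mul_assoc (ℓ / (2 * B))]
  exact deviation_exponent_of_le_excess ha hζ hψ hτ hx hn hnH hxe

end Deviation

/-! ### Underestimation of an arm -/

/-- The largest amount by which a saturated mean of arm `k` in epoch `e` falls short of its mean
by more than `ζ` times the confidence width. -/
def underestimation {K : ℕ} (F : Environment K) (a ζ : ℝ) (τ e : ℕ) (k : Fin K) (T : ℕ)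
    (ω : ℕ → Fin K × ℝ) : ℝ :=
  ((Finset.range T).sup fun t => (excess F a ζ τ e k (-1) t ω).toNNReal : NNReal)

section Underestimation

variable {K : ℕ} {π : Policy K} {F : Environment K} {T : ℕ} {P : Measure (ℕ → Fin K × ℝ)}
  {a ζ : ℝ} {τ : ℕ}

lemma underestimation_nonneg (e : ℕ) (k : Fin K) (ω : ℕ → Fin K × ℝ) :
    0 ≤ underestimation F a ζ τ e k T ω :=
  NNReal.coe_nonneg _

lemma excess_le_underestimation (e : ℕ) (k : Fin K) {t : ℕ} (ht : t < T)
    (ω : ℕ → Fin K × ℝ) :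
    excess F a ζ τ e k (-1) t ω ≤ underestimation F a ζ τ e k T ω :=
  (Real.le_coe_toNNReal _).trans <| NNReal.coe_le_coe.2 <|
    Finset.le_sup (f := fun t => (excess F a ζ τ e k (-1) t ω).toNNReal) (Finset.mem_range.2 ht)

lemma measurable_underestimation (F : Environment K) (a ζ : ℝ) (τ e : ℕ) (k : Fin K) (T : ℕ) :
    Measurable (underestimation F a ζ τ e k T) := by
  have hsup : Measurable
      ((Finset.range T).sup fun t ω => (excess F a ζ τ e k (-1) t ω).toNNReal) :=
    Finset.sup_induction measurable_const (fun _ hf _ hg => hf.sup hg) fun t _ =>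
      (measurable_excess F a ζ τ e k (-1) t).real_toNNReal
  convert hsup.coe_nnreal_real using 2 with ω
  simp [underestimation, Finset.sup_apply]

lemma exists_lt_excess_of_lt_underestimation {e : ℕ} {k : Fin K} {ω : ℕ → Fin K × ℝ} {x : ℝ}
    (hx : 0 ≤ x) (h : x < underestimation F a ζ τ e k T ω) :
    ∃ t < T, 0 < (armSlots τ e k t ω).card ∧ x < excess F a ζ τ e k (-1) t ω := by
  lift x to NNReal using hx
  rw [underestimation, NNReal.coe_lt_coe, Finset.lt_sup_iff] at h
  obtain ⟨t, ht, hlt⟩ := h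
  have hxt := Real.lt_toNNReal_iff_coe_lt.1 hlt
  refine ⟨t, Finset.mem_range.1 ht, Nat.pos_of_ne_zero fun h0 => ?_, hxt⟩
  have hzero : excess F a ζ τ e k (-1) t ω = 0 := by simp [excess, h0, confWidth]
  exact (hzero ▸ hxt).not_ge x.coe_nonneg

namespace IsPathLaw

lemma measure_lt_underestimation_le (hP : IsPathLaw π F T P) (hF : HeavyTailed F T)
    (ha : 1 < a) (hζ : 0 < ζ) (hψ : psi (2 * ζ / a) ≥ 2 * a / ζ) (hτ : 0 < τ)
    (e : ℕ) (k : Fin K) {x : ℝ} (hx : 0 ≤ x) :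
    P {ω | x < underestimation F a ζ τ e k T ω} ≤
      ENNReal.ofReal (∑ s ∈ Finset.range (⌊Real.logb a T⌋₊ + 1),
        Real.exp (-lnPlus (τ / (K * a ^ (s + 1))))
          * Real.exp (-(devRate a ζ * √(a ^ (s + 1)) * x))) := by
  have hcover : {ω | x < underestimation F a ζ τ e k T ω} ⊆
      ⋃ s ∈ Finset.range (⌊Real.logb a T⌋₊ + 1),
        {ω | ∃ t ≤ T, 0 < (armSlots τ e k t ω).card ∧
          gridUp a (armSlots τ e k t ω).card = a ^ (s + 1) ∧
          x ≤ excess F a ζ τ e k (-1) t ω} := by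
    intro ω hω
    obtain ⟨t, ht, hn, hxt⟩ := exists_lt_excess_of_lt_underestimation hx hω
    obtain ⟨s, hs, hgrid⟩ :=
      exists_gridUp_eq_pow ha hn ((card_armSlots_le τ e k t ω).trans ht.le)
    exact Set.mem_biUnion hs ⟨t, ht.le, hn, hgrid, hxt.le⟩
  rw [ENNReal.ofReal_sum_of_nonneg fun _ _ => by positivity]
  exact (measure_mono hcover).trans <| (measure_biUnion_finset_le _ _).trans <|
    Finset.sum_le_sum fun s _ => hP.measure_exists_le_excess hF ha hζ hψ hτ e k (by simp)
      (by positivity) hx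

lemma lintegral_underestimation_le (hP : IsPathLaw π F T P) (hF : HeavyTailed F T)
    (ha : 1 < a) (hζ : 0 < ζ) (hψ : psi (2 * ζ / a) ≥ 2 * a / ζ) (hτ : 0 < τ)
    (e : ℕ) (k : Fin K) :
    ∫⁻ ω, ENNReal.ofReal (underestimation F a ζ τ e k T ω) ∂P ≤
      ENNReal.ofReal (2 * (1 + √a) / (√a - 1) / devRate a ζ * criticalGap τ K) := by
  have ha0 : 0 < a := zero_lt_one.trans ha
  have hc := devRate_pos ha0 hζ
  have hδ := criticalGap_pos hτ (Fin.pos k)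
  have hsqrt : ∀ s : ℕ, √(a ^ (s + 1)) = √a ^ s * √a := fun s => by
    rw [← pow_succ, Real.sqrt_eq_iff_mul_self_eq (by positivity) (by positivity), ← mul_pow,
      Real.mul_self_sqrt ha0.le]
  refine (lintegral_ofReal_le_of_exp_tail (measurable_underestimation F a ζ τ e k T).aemeasurable
    (underestimation_nonneg e k) (fun s _ => (Real.exp_pos _).le) (fun s _ => by positivity)
    fun x hx => hP.measure_lt_underestimation_le hF ha hζ hψ hτ e k hx.le).trans
    (ENNReal.ofReal_le_ofReal ?_)
  calc ∑ s ∈ Finset.range (⌊Real.logb a T⌋₊ + 1),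
        Real.exp (-lnPlus (τ / (K * a ^ (s + 1)))) / (devRate a ζ * √(a ^ (s + 1)))
      ≤ ∑ s ∈ Finset.range (⌊Real.logb a T⌋₊ + 1), criticalGap τ K / devRate a ζ
          * min (√a ^ s * (√a * criticalGap τ K)) (√a ^ s * (√a * criticalGap τ K))⁻¹ := by
        refine Finset.sum_le_sum fun s _ => ?_
        rw [← mul_assoc (√a ^ s), ← hsqrt]
        exact exp_neg_lnPlus_div_le hτ (Fin.pos k) hc (by positivity)
    _ ≤ criticalGap τ K / devRate a ζ * (2 * (1 + √a) / (√a - 1)) := by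
        rw [← Finset.mul_sum]
        gcongr
        exact sum_min_geometric_le (Real.lt_sqrt_of_sq_lt (by simpa using ha)) (by positivity) _
    _ = _ := by ring

lemma integrable_underestimation (hP : IsPathLaw π F T P) (hF : HeavyTailed F T)
    (ha : 1 < a) (hζ : 0 < ζ) (hψ : psi (2 * ζ / a) ≥ 2 * a / ζ) (hτ : 0 < τ)
    (e : ℕ) (k : Fin K) : Integrable (underestimation F a ζ τ e k T) P :=
  integrable_of_lintegral_ofReal_le (measurable_underestimation F a ζ τ e k T).aestronglyMeasurable
    (underestimation_nonneg e k) (hP.lintegral_underestimation_le hF ha hζ hψ hτ e k)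

lemma integral_underestimation_le (hP : IsPathLaw π F T P) (hF : HeavyTailed F T)
    (ha : 1 < a) (hζ : 0 < ζ) (hψ : psi (2 * ζ / a) ≥ 2 * a / ζ) (hτ : 0 < τ)
    (e : ℕ) (k : Fin K) :
    ∫ ω, underestimation F a ζ τ e k T ω ∂P ≤
      2 * (1 + √a) / (√a - 1) / devRate a ζ * criticalGap τ K := by
  have hc := devRate_pos (zero_lt_one.trans ha) hζ
  have hb : 1 < √a := Real.lt_sqrt_of_sq_lt (by simpa using ha)
  rw [integral_eq_lintegral_of_nonneg_ae (.of_forall (underestimation_nonneg e k))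
    (measurable_underestimation F a ζ τ e k T).aestronglyMeasurable]
  refine ENNReal.toReal_le_of_le_ofReal ?_ (hP.lintegral_underestimation_le hF ha hζ hψ hτ e k)
  have := criticalGap_pos hτ (Fin.pos k)
  have := sub_pos.2 hb
  positivity

end IsPathLaw

end Underestimation

/-! ### Overestimation of an arm -/

/-- The event that arm `k` overshoots its mean by `x` beyond `ζ` times the confidence width when it
has been selected `m` times in epoch `e`. -/
def exceedEvent {K : ℕ} (F : Environment K) (a ζ : ℝ) (τ e : ℕ) (k : Fin K) (T : ℕ) (x : ℝ)
    (m : ℕ) : Set (ℕ → Fin K × ℝ) :=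
  {ω | ∃ t ≤ T, (armSlots τ e k t ω).card = m ∧ x ≤ excess F a ζ τ e k 1 t ω}

lemma exp_neg_le_div_pow_four {y : ℝ} (hy : 0 < y) : Real.exp (-y) ≤ 24 / y ^ 4 := by
  have h := Real.pow_div_factorial_le_exp y hy.le 4
  rw [Real.exp_neg, inv_le_comm₀ (Real.exp_pos _) (by positivity), inv_div]
  simpa [Nat.factorial] using h

section Overestimation

variable {K : ℕ} {π : Policy K} {F : Environment K} {T : ℕ} {P : Measure (ℕ → Fin K × ℝ)}
  {a ζ : ℝ} {τ : ℕ}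

lemma measurableSet_exceedEvent (F : Environment K) (a ζ : ℝ) (τ e : ℕ) (k : Fin K) (T : ℕ)
    (x : ℝ) (m : ℕ) : MeasurableSet (exceedEvent F a ζ τ e k T x m) := by
  simp only [exceedEvent, Set.ofPred_exists, Set.ofPred_and]
  exact .iUnion fun t => (MeasurableSet.const _).inter <|
    (measurable_card_armSlots τ e k t (measurableSet_singleton m)).inter
      (measurableSet_le measurable_const (measurable_excess F a ζ τ e k 1 t))

lemma IsPathLaw.measureReal_exceedEvent_le (hP : IsPathLaw π F T P) (hF : HeavyTailed F T)
    (ha : 1 < a) (hζ : 0 < ζ) (hψ : psi (2 * ζ / a) ≥ 2 * a / ζ) (hτ : 0 < τ)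
    (e : ℕ) (k : Fin K) {x : ℝ} (hx : 0 < x) {m : ℕ} (hm : 0 < m) :
    P.real (exceedEvent F a ζ τ e k T x m) ≤ 24 / (devRate a ζ * x) ^ 4 * ((m : ℝ) ^ 2)⁻¹ := by
  have hc := devRate_pos (zero_lt_one.trans ha) hζ
  have hm' : (0 : ℝ) < m := Nat.cast_pos.2 hm
  have hsubset : exceedEvent F a ζ τ e k T x m ⊆ {ω | ∃ t ≤ T, 0 < (armSlots τ e k t ω).card ∧
      gridUp a (armSlots τ e k t ω).card = gridUp a m ∧ x ≤ excess F a ζ τ e k 1 t ω} := by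
    rintro ω ⟨t, ht, rfl, hxe⟩
    exact ⟨t, ht, hm, rfl, hxe⟩
  refine ENNReal.toReal_le_of_le_ofReal (by positivity) ((measure_mono hsubset).trans <|
    (hP.measure_exists_le_excess hF ha hζ hψ hτ e k abs_one
      (gridUp_pos (zero_lt_one.trans ha) m) hx.le).trans (ENNReal.ofReal_le_ofReal ?_))
  calc Real.exp (-lnPlus (τ / (K * gridUp a m)))
        * Real.exp (-(devRate a ζ * √(gridUp a m) * x))
      ≤ 1 * Real.exp (-(devRate a ζ * √m * x)) := by
        gcongr
        · exact exp_neg_lnPlus_le_one _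
        · exact le_gridUp ha hm
    _ ≤ 24 / (devRate a ζ * √m * x) ^ 4 := by
        rw [one_mul]
        exact exp_neg_le_div_pow_four (by positivity)
    _ = 24 / (devRate a ζ * x) ^ 4 * ((√m ^ 2) ^ 2)⁻¹ := by field_simp
    _ = _ := by rw [Real.sq_sqrt hm'.le]

lemma IsPathLaw.sum_measureReal_exceedEvent_le (hP : IsPathLaw π F T P) (hF : HeavyTailed F T)
    (ha : 1 < a) (hζ : 0 < ζ) (hψ : psi (2 * ζ / a) ≥ 2 * a / ζ) (hτ : 0 < τ)
    (e : ℕ) (k : Fin K) {x : ℝ} (hx : 0 < x) {N : ℕ} (hN : 0 < N) :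
    ∑ m ∈ Finset.Ioc N T, P.real (exceedEvent F a ζ τ e k T x m)
      ≤ 24 / (devRate a ζ * x) ^ 4 / N := by
  have hc := devRate_pos (zero_lt_one.trans ha) hζ
  have hinv : ∑ m ∈ Finset.Ioc N T, ((m : ℝ) ^ 2)⁻¹ ≤ (N : ℝ)⁻¹ := by
    rcases le_total N T with h | h
    · exact (sum_Ioc_inv_sq_le_sub hN.ne' h).trans (sub_le_self _ (by positivity))
    · simp [Finset.Ioc_eq_empty_of_le h]
  calc _ ≤ ∑ m ∈ Finset.Ioc N T, 24 / (devRate a ζ * x) ^ 4 * ((m : ℝ) ^ 2)⁻¹ :=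
        Finset.sum_le_sum fun m hm => hP.measureReal_exceedEvent_le hF ha hζ hψ hτ e k hx
          (hN.trans (Finset.mem_Ioc.1 hm).1)
    _ ≤ 24 / (devRate a ζ * x) ^ 4 * (N : ℝ)⁻¹ := by
        rw [← Finset.mul_sum]
        gcongr
    _ = _ := (div_eq_mul_inv _ _).symm

end Overestimation

/-! ### Upper confidence bounds along a trajectory -/

/-- The variation of the mean rewards in epoch `e`, including the step to the next epoch. -/
def epochVariation {K : ℕ} (F : Environment K) (τ T e : ℕ) : ℝ :=
  ∑ t ∈ Finset.range (T - 1) with t / τ = e, ⨆ k, |mean F (t + 1) k - mean F t k|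

lemma abs_sum_div_card_sub_le {ι : Type*} {s : Finset ι} (hs : s.Nonempty) {f : ι → ℝ} {m r : ℝ}
    (h : ∀ i ∈ s, |f i - m| ≤ r) : |(∑ i ∈ s, f i) / s.card - m| ≤ r := by
  have hcard : (0 : ℝ) < s.card := Nat.cast_pos.2 hs.card_pos
  have hcenter : (∑ i ∈ s, f i) / s.card - m = (∑ i ∈ s, (f i - m)) / s.card := by
    rw [Finset.sum_sub_distrib, Finset.sum_const, nsmul_eq_mul]
    field_simp
  rw [hcenter, abs_div, abs_of_pos hcard, div_le_iff₀' hcard, ← nsmul_eq_mul]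
  exact (Finset.abs_sum_le_sum_abs _ _).trans (Finset.sum_le_card_nsmul _ _ _ h)

section Trajectory

variable {K : ℕ} {F : Environment K} {T : ℕ} {a ζ : ℝ} {τ : ℕ}

lemma epochVariation_nonneg (F : Environment K) (τ T e : ℕ) : 0 ≤ epochVariation F τ T e :=
  Finset.sum_nonneg fun _ _ => Real.iSup_nonneg fun _ => abs_nonneg _

lemma sum_epochVariation (F : Environment K) (τ T : ℕ) :
    ∑ e ∈ (Finset.range T).image (· / τ), epochVariation F τ T e = totalVariation F T :=
  Finset.sum_fiberwise_of_maps_to (fun _ ht => Finset.mem_image_of_mem _ <|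
    Finset.range_subset_range.2 (Nat.sub_le T 1) ht) _

lemma abs_mean_sub_le_epochVariation {e s : ℕ} (hτ : 0 < τ) (hs : s < T) (hse : s / τ = e)
    (k : Fin K) : |mean F s k - mean F (e * τ) k| ≤ epochVariation F τ T e := by
  have hle : e * τ ≤ s := hse ▸ Nat.div_mul_le_self s τ
  have hpath := dist_le_Ico_sum_of_dist_le (f := fun t => mean F t k) hle
    (d := fun t => ⨆ j, |mean F (t + 1) j - mean F t j|) fun {t} _ _ => by
      rw [dist_comm, Real.dist_eq]
      exact le_ciSup (f := fun j => |mean F (t + 1) j - mean F t j|)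
        (Set.finite_range _).bddAbove k
  rw [dist_comm, Real.dist_eq] at hpath
  refine hpath.trans (Finset.sum_le_sum_of_subset_of_nonneg (fun t ht => ?_)
    fun _ _ _ => Real.iSup_nonneg fun _ => abs_nonneg _)
  rw [Finset.mem_Ico] at ht
  rw [Finset.mem_filter, Finset.mem_range]
  exact ⟨by omega, le_antisymm (hse ▸ Nat.div_le_div_right ht.2.le)
    ((Nat.le_div_iff_mul_le hτ).2 ht.1)⟩

lemma sum_pulls_past (τ t : ℕ) (k : Fin K) (ω : ℕ → Fin K × ℝ) {M : Type*} [AddCommMonoid M]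
    (f : ℕ → M) :
    ∑ s ∈ pulls τ (past t ω) k, f s = ∑ s ∈ armSlots τ (t / τ) k t ω, f s := by
  simp only [pulls, armSlots, Finset.sum_filter]
  exact Fin.sum_univ_eq_sum_range (fun s => if s / τ = t / τ ∧ (ω s).1 = k then f s else 0) t

lemma card_pulls_past (τ t : ℕ) (k : Fin K) (ω : ℕ → Fin K × ℝ) :
    (pulls τ (past t ω) k).card = (armSlots τ (t / τ) k t ω).card := by
  simpa only [Finset.card_eq_sum_ones] using sum_pulls_past τ t k ω fun _ => 1

lemma ucb_past (F : Environment K) (a ζ : ℝ) {t e : ℕ} (he : t / τ = e) (k : Fin K)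
    (ω : ℕ → Fin K × ℝ) :
    ucb a ζ τ (past t ω) k =
      deviation F τ e k (satLimit a τ K (armSlots τ e k t ω).card) t ω / (armSlots τ e k t ω).card
        + (∑ s ∈ armSlots τ e k t ω,
          ∫ x, sat x (satLimit a τ K (armSlots τ e k t ω).card) ∂(F s k : Measure ℝ)) /
          (armSlots τ e k t ω).card
        + (1 + ζ) * confWidth τ K (armSlots τ e k t ω).card := by
  subst he
  rw [ucb, satMean, card_pulls_past, deviation, Finset.sum_sub_distrib, ← add_div, sub_add_cancel,
    ← sum_pulls_past τ t k ω fun s => sat (ω s).2 _]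
  rfl

lemma abs_sum_integral_sat_div_sub_le (hF : HeavyTailed F T) (ha : 1 < a) {t e : ℕ}
    (hτ : 0 < τ) (ht : t < T) (k : Fin K) {ω : ℕ → Fin K × ℝ}
    (hn : 0 < (armSlots τ e k t ω).card) :
    |(∑ s ∈ armSlots τ e k t ω,
        ∫ x, sat x (satLimit a τ K (armSlots τ e k t ω).card) ∂(F s k : Measure ℝ)) /
        (armSlots τ e k t ω).card - mean F (e * τ) k| ≤
      epochVariation F τ T e + confWidth τ K (armSlots τ e k t ω).card := by
  refine abs_sum_div_card_sub_le (Finset.card_pos.1 hn) fun s hs => ?_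
  obtain ⟨hst, hse, -⟩ := by simpa only [armSlots, Finset.mem_filter, Finset.mem_range] using hs
  have hbias := hF.abs_integral_sat_sub_mean_le (hst.trans ht) k
    (gridLimit_pos τ K (gridUp_pos (zero_lt_one.trans ha) (armSlots τ e k t ω).card))
  have hwidth := inv_gridLimit_le_confWidth hτ (Fin.pos k) hn (le_gridUp ha hn)
  have hdrift := abs_mean_sub_le_epochVariation (F := F) hτ (hst.trans ht) hse k
  rw [add_comm (epochVariation F τ T e)]
  exact (abs_sub_le _ (mean F s k) _).trans (add_le_add (hbias.trans hwidth) hdrift)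

lemma ucb_past_le (hF : HeavyTailed F T) (ha : 1 < a) (ζ : ℝ) {t e : ℕ} (hτ : 0 < τ)
    (ht : t < T) (he : t / τ = e) (k : Fin K) {ω : ℕ → Fin K × ℝ}
    (hn : 0 < (armSlots τ e k t ω).card) :
    ucb a ζ τ (past t ω) k ≤ mean F (e * τ) k + epochVariation F τ T e +
      (2 + 2 * ζ) * confWidth τ K (armSlots τ e k t ω).card + excess F a ζ τ e k 1 t ω := by
  have h := (abs_le.1 (abs_sum_integral_sat_div_sub_le hF ha hτ ht k hn)).2
  rw [ucb_past F a ζ he, excess, one_mul]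
  linarith

lemma le_ucb_past (hF : HeavyTailed F T) (ha : 1 < a) (ζ : ℝ) {t e : ℕ} (hτ : 0 < τ)
    (ht : t < T) (he : t / τ = e) (k : Fin K) {ω : ℕ → Fin K × ℝ}
    (hn : 0 < (armSlots τ e k t ω).card) :
    mean F (e * τ) k - epochVariation F τ T e - excess F a ζ τ e k (-1) t ω ≤
      ucb a ζ τ (past t ω) k := by
  have h := (abs_le.1 (abs_sum_integral_sat_div_sub_le hF ha hτ ht k hn)).1
  rw [ucb_past F a ζ he, excess, neg_one_mul, neg_div]
  linarith

lemma Admissible.mean_sub_mean_le_or (hF : HeavyTailed F T) (ha : 1 < a) (hζ : 0 < ζ)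
    {t e : ℕ} (hτ : 0 < τ) (ht : t < T) (he : t / τ = e) (j : Fin K) {k : Fin K}
    {ω : ℕ → Fin K × ℝ} (hadm : Admissible a ζ τ (past t ω) k) {Δ : ℝ}
    (hΔ : mean F (e * τ) j - mean F (e * τ) k = Δ) :
    Δ ≤ 6 * epochVariation F τ T e + 3 * underestimation F a ζ τ e j T ω + criticalGap τ K ∨
    criticalGap τ K < Δ ∧ ((armSlots τ e k t ω).card ≤ burnIn ζ τ K Δ ∨
      ω ∈ exceedEvent F a ζ τ e k T (Δ / 6) (armSlots τ e k t ω).card) := by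
  refine or_iff_not_imp_left.2 fun hlarge => ?_
  have hδ := criticalGap_pos hτ (Fin.pos k)
  have hv := epochVariation_nonneg F τ T e
  have hZ := underestimation_nonneg (F := F) (a := a) (ζ := ζ) (τ := τ) (T := T) e j ω
  have hδΔ : criticalGap τ K < Δ := by linarith
  refine ⟨hδΔ, or_iff_not_imp_left.2 fun hN => ⟨t, ht.le, rfl, ?_⟩⟩
  rcases hadm with hnew | ⟨htried, hmax⟩
  · rw [← he, ← card_pulls_past, hnew, Finset.card_empty] at hN
    exact absurd (Nat.zero_le _) hN
  have hpos : ∀ i, 0 < (armSlots τ e i t ω).card := fun i => by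
    rw [← he, ← card_pulls_past, Finset.card_pos, Finset.nonempty_iff_ne_empty]
    exact htried i
  have hupper := ucb_past_le hF ha ζ hτ ht he k (hpos k)
  have hlower := le_ucb_past hF ha ζ hτ ht he j (hpos j)
  have hunder := excess_le_underestimation (F := F) (a := a) (ζ := ζ) (τ := τ) e j ht ω
  have hwidth := confWidth_le_of_burnIn_le hτ (Fin.pos k) hζ hδΔ.le (not_le.1 hN).le
  linarith [hmax j, not_le.1 hlarge]

end Trajectory

/-! ### The cost of an arm -/

/-- The regret charged to the selection of an arm `k` of gap `Δ` at time `t` when it is due neither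
to the drift of the means nor to an underestimation of the best arm: `k` has been tried only rarely,
or it is overestimated. -/
def rareCost {K : ℕ} (F : Environment K) (a ζ : ℝ) (τ e : ℕ) (k : Fin K) (T : ℕ) (Δ : ℝ) (t : ℕ)
    (ω : ℕ → Fin K × ℝ) : ℝ :=
  open Classical in
  if criticalGap τ K < Δ ∧ ((armSlots τ e k t ω).card ≤ burnIn ζ τ K Δ ∨
      ω ∈ exceedEvent F a ζ τ e k T (Δ / 6) (armSlots τ e k t ω).card) then Δ
  else 0

/-- A bound on the sum of `rareCost` over the selections of arm `k` in epoch `e`; the sum over `m`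
runs over the possible numbers of earlier selections. -/
def armCost {K : ℕ} (F : Environment K) (a ζ : ℝ) (τ e : ℕ) (k : Fin K) (T : ℕ) (Δ : ℝ)
    (ω : ℕ → Fin K × ℝ) : ℝ :=
  if criticalGap τ K < Δ then
    Δ * (burnIn ζ τ K Δ + 1 + ∑ m ∈ Finset.Ioc (burnIn ζ τ K Δ) T,
      (exceedEvent F a ζ τ e k T (Δ / 6) m).indicator (fun _ => 1) ω)
  else 0

section ArmCost

variable {K : ℕ} {π : Policy K} {F : Environment K} {T : ℕ} {P : Measure (ℕ → Fin K × ℝ)}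
  {a ζ : ℝ} {τ : ℕ}

lemma card_armSlots_lt {e s t : ℕ} {k : Fin K} {ω : ℕ → Fin K × ℝ}
    (hs : s ∈ armSlots τ e k T ω) (hst : s < t) :
    (armSlots τ e k s ω).card < (armSlots τ e k t ω).card := by
  refine Finset.card_lt_card <| (Finset.ssubset_iff_of_subset <|
    Finset.filter_subset_filter _ (Finset.range_subset_range.2 hst.le)).2 ⟨s, ?_, by simp⟩
  exact Finset.mem_filter.2 ⟨Finset.mem_range.2 hst, (Finset.mem_filter.1 hs).2⟩

lemma card_armSlots_injOn (τ e : ℕ) (k : Fin K) (ω : ℕ → Fin K × ℝ) (T : ℕ) :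
    Set.InjOn (fun t => (armSlots τ e k t ω).card) (armSlots τ e k T ω) := by
  intro s hs t ht h
  by_contra hne
  rcases lt_or_gt_of_ne hne with hlt | hgt
  · exact (card_armSlots_lt hs hlt).ne h
  · exact (card_armSlots_lt ht hgt).ne' h

lemma card_filter_armSlots_le (τ e : ℕ) (k : Fin K) (ω : ℕ → Fin K × ℝ) (T : ℕ) (p : ℕ → Prop)
    [DecidablePred p] :
    {t ∈ armSlots τ e k T ω | p (armSlots τ e k t ω).card}.card ≤
      {m ∈ Finset.range T | p m}.card := by
  refine Finset.card_le_card_of_injOn (fun t => (armSlots τ e k t ω).card) (fun t ht => ?_)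
    ((card_armSlots_injOn τ e k ω T).mono (Finset.coe_subset.2 (Finset.filter_subset _ _)))
  obtain ⟨hmem, hp⟩ := Finset.mem_filter.1 ht
  have htT := Finset.mem_range.1 (Finset.mem_filter.1 hmem).1
  exact Finset.mem_coe.2 (Finset.mem_filter.2
    ⟨Finset.mem_range.2 ((card_armSlots_le τ e k t ω).trans_lt htT), hp⟩)

lemma rareCost_nonneg {Δ : ℝ} (hΔ : 0 ≤ Δ) (e : ℕ) (k : Fin K) (t : ℕ) (ω : ℕ → Fin K × ℝ) :
    0 ≤ rareCost F a ζ τ e k T Δ t ω := by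
  unfold rareCost
  split_ifs <;> [exact hΔ; exact le_rfl]

open Classical in
lemma sum_rareCost_le_armCost {Δ : ℝ} (hΔ : 0 ≤ Δ) (e : ℕ) (k : Fin K) (ω : ℕ → Fin K × ℝ) :
    ∑ t ∈ armSlots τ e k T ω, rareCost F a ζ τ e k T Δ t ω ≤ armCost F a ζ τ e k T Δ ω := by
  by_cases hδ : criticalGap τ K < Δ
  swap
  · simp [rareCost, armCost, hδ]
  set N := burnIn ζ τ K Δ
  set E := exceedEvent F a ζ τ e k T (Δ / 6)
  have hcover : {m ∈ Finset.range T | m ≤ N ∨ ω ∈ E m} ⊆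
      Finset.range (N + 1) ∪ {m ∈ Finset.Ioc N T | ω ∈ E m} := by
    intro m hm
    simp only [Finset.mem_filter, Finset.mem_range, Finset.mem_union, Finset.mem_Ioc] at hm ⊢
    rcases le_or_gt m N with h | h
    · exact .inl (Nat.lt_succ_of_le h)
    · exact .inr ⟨⟨h, hm.1.le⟩, hm.2.resolve_left h.not_ge⟩
  have hcard : {t ∈ armSlots τ e k T ω | (armSlots τ e k t ω).card ≤ N ∨
      ω ∈ E (armSlots τ e k t ω).card}.card ≤
        N + 1 + {m ∈ Finset.Ioc N T | ω ∈ E m}.card := by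
    refine (card_filter_armSlots_le τ e k ω T fun m => m ≤ N ∨ ω ∈ E m).trans ?_
    refine (Finset.card_le_card hcover).trans ((Finset.card_union_le _ _).trans_eq ?_)
    rw [Finset.card_range]
  simp only [rareCost, armCost, hδ, true_and, if_true]
  rw [← Finset.sum_filter, Finset.sum_const, nsmul_eq_mul, mul_comm]
  refine mul_le_mul_of_nonneg_left ?_ hΔ
  calc _ ≤ ((N + 1 + {m ∈ Finset.Ioc N T | ω ∈ E m}.card : ℕ) : ℝ) := Nat.cast_le.2 hcard
    _ = _ := by simp [N, E, Set.indicator_apply]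

lemma integrable_indicator_exceedEvent [IsFiniteMeasure P] (e : ℕ) (k : Fin K) (x : ℝ) (m : ℕ) :
    Integrable ((exceedEvent F a ζ τ e k T x m).indicator fun _ => (1 : ℝ)) P :=
  (integrable_const _).indicator (measurableSet_exceedEvent F a ζ τ e k T x m)

lemma integrable_armCost [IsFiniteMeasure P] (e : ℕ) (k : Fin K) (Δ : ℝ) :
    Integrable (armCost F a ζ τ e k T Δ) P := by
  unfold armCost
  split_ifs
  · exact ((integrable_const _).add (integrable_finsetSum _ fun m _ =>
      integrable_indicator_exceedEvent e k _ m)).const_mul _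
  · exact integrable_const _

namespace IsPathLaw

lemma sum_measureReal_exceedEvent_burnIn_le (hP : IsPathLaw π F T P) (hF : HeavyTailed F T)
    (ha : 1 < a) (hζ : 0 < ζ) (hψ : psi (2 * ζ / a) ≥ 2 * a / ζ) (hτ : 0 < τ)
    (e : ℕ) (k : Fin K) {Δ : ℝ} (hΔ : criticalGap τ K < Δ) :
    ∑ m ∈ Finset.Ioc (burnIn ζ τ K Δ) T, P.real (exceedEvent F a ζ τ e k T (Δ / 6) m)
      ≤ 24 * 6 ^ 4 / devRate a ζ ^ 4 / (criticalGap τ K * Δ) := by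
  have hc := devRate_pos (zero_lt_one.trans ha) hζ
  have hδ := criticalGap_pos hτ (Fin.pos k)
  set δ := criticalGap τ K
  have hΔ0 : 0 < Δ := hδ.trans hΔ
  have hN : (δ * Δ)⁻¹ ≤ burnIn ζ τ K Δ := by
    refine le_trans ?_ (Nat.le_ceil _)
    rw [inv_eq_one_div]
    gcongr
    nlinarith
  have hN0 : 0 < burnIn ζ τ K Δ := Nat.cast_pos.1 ((by positivity : 0 < (δ * Δ)⁻¹).trans_le hN)
  calc _ ≤ 24 / (devRate a ζ * (Δ / 6)) ^ 4 / burnIn ζ τ K Δ :=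
        hP.sum_measureReal_exceedEvent_le hF ha hζ hψ hτ e k (by positivity) hN0
    _ ≤ 24 / (devRate a ζ * (Δ / 6)) ^ 4 / (δ * Δ)⁻¹ := by gcongr
    _ = 24 * 6 ^ 4 / devRate a ζ ^ 4 / (δ * Δ) * (δ / Δ) ^ 2 := by field_simp
    _ ≤ 24 * 6 ^ 4 / devRate a ζ ^ 4 / (δ * Δ) :=
        mul_le_of_le_one_right (by positivity)
          (pow_le_one₀ (by positivity) ((div_le_one hΔ0).2 hΔ.le))

lemma integral_armCost_le (hP : IsPathLaw π F T P) (hF : HeavyTailed F T)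
    (ha : 1 < a) (hζ : 0 < ζ) (hψ : psi (2 * ζ / a) ≥ 2 * a / ζ) (hτ : 0 < τ)
    (e : ℕ) (k : Fin K) {Δ : ℝ} (hΔ2 : Δ ≤ 2) :
    ∫ ω, armCost F a ζ τ e k T Δ ω ∂P ≤
      4 + (2 * (12 * (1 + ζ)) ^ 2 + 24 * 6 ^ 4 / devRate a ζ ^ 4) / criticalGap τ K := by
  have := hP.isProbabilityMeasure
  have hc := devRate_pos (zero_lt_one.trans ha) hζ
  have hδ := criticalGap_pos hτ (Fin.pos k)
  have htail := hP.sum_measureReal_exceedEvent_burnIn_le hF ha hζ hψ hτ e k (Δ := Δ)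
  by_cases hΔ : criticalGap τ K < Δ
  swap
  · simp only [armCost, hΔ, if_false, integral_zero]
    positivity
  have hΔ0 : 0 < Δ := hδ.trans hΔ
  have hN : (burnIn ζ τ K Δ : ℝ) ≤ 2 * (12 * (1 + ζ)) ^ 2 / (criticalGap τ K * Δ) + 1 :=
    (Nat.ceil_lt_add_one (by positivity)).le
  simp only [armCost, hΔ, if_true]
  rw [integral_const_mul, integral_add (integrable_const _) (integrable_finsetSum _ fun m _ =>
      integrable_indicator_exceedEvent e k _ m),
    integral_finsetSum _ fun m _ => integrable_indicator_exceedEvent e k _ m]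
  simp only [integral_const, probReal_univ, smul_eq_mul, one_mul, mul_one,
    integral_indicator_const _ (measurableSet_exceedEvent F a ζ τ e k T _ _)]
  calc _ ≤ Δ * (2 * (12 * (1 + ζ)) ^ 2 / (criticalGap τ K * Δ) + 1 + 1
          + 24 * 6 ^ 4 / devRate a ζ ^ 4 / (criticalGap τ K * Δ)) := by
        gcongr
        exact htail hΔ
    _ = 2 * Δ + (2 * (12 * (1 + ζ)) ^ 2 + 24 * 6 ^ 4 / devRate a ζ ^ 4) / criticalGap τ K := by
        field_simp
        ring
    _ ≤ _ := by linarith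

end IsPathLaw

end ArmCost

/-! ### The regret of an epoch -/

section Epoch

variable {K : ℕ} {π : Policy K} {F : Environment K} {T : ℕ} {P : Measure (ℕ → Fin K × ℝ)}
  {a ζ : ℝ} {τ : ℕ}

lemma card_epoch_le (hτ : 0 < τ) (T e : ℕ) : {t ∈ Finset.range T | t / τ = e}.card ≤ τ := by
  have hsub : {t ∈ Finset.range T | t / τ = e} ⊆ Finset.Ico (e * τ) ((e + 1) * τ) := by
    intro t ht
    have hte := (Finset.mem_filter.1 ht).2
    exact Finset.mem_Ico.2 ⟨(Nat.le_div_iff_mul_le hτ).1 hte.ge,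
      (Nat.div_lt_iff_lt_mul hτ).1 (Nat.lt_succ_of_le hte.le)⟩
  simpa [add_mul] using Finset.card_le_card hsub

lemma HeavyTailed.gap_le_two (hF : HeavyTailed F T) {t : ℕ} (ht : t < T) (ω : ℕ → Fin K × ℝ) :
    gap F t ω ≤ 2 := by
  have : Nonempty (Fin K) := ⟨(ω t).1⟩
  have hbest : bestMean F t ≤ 1 := ciSup_le fun j => (abs_le.1 (hF.abs_mean_le_one ht j)).2
  have hmean := (abs_le.1 (hF.abs_mean_le_one ht (ω t).1)).1
  rw [gap]
  linarith

lemma gap_le_mean_sub_mean_add (hτ : 0 < τ) {t e : ℕ} (ht : t < T) (he : t / τ = e) {j : Fin K}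
    (hj : ∀ k, mean F (e * τ) k ≤ mean F (e * τ) j) (ω : ℕ → Fin K × ℝ) :
    gap F t ω ≤
      mean F (e * τ) j - mean F (e * τ) (ω t).1 + 2 * epochVariation F τ T e := by
  have : Nonempty (Fin K) := ⟨j⟩
  have hbest : bestMean F t ≤ mean F (e * τ) j + epochVariation F τ T e := ciSup_le fun i => by
    linarith [hj i, (abs_le.1 (abs_mean_sub_le_epochVariation (F := F) hτ ht he i)).2]
  have hmean := (abs_le.1 (abs_mean_sub_le_epochVariation (F := F) hτ ht he (ω t).1)).1
  rw [gap]
  linarith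

lemma gap_le_add_rareCost (hF : HeavyTailed F T) (ha : 1 < a) (hζ : 0 < ζ) (hτ : 0 < τ)
    {t e : ℕ} (ht : t < T) (he : t / τ = e) {j : Fin K}
    (hj : ∀ k, mean F (e * τ) k ≤ mean F (e * τ) j) {ω : ℕ → Fin K × ℝ}
    (hadm : Admissible a ζ τ (past t ω) (ω t).1) :
    gap F t ω ≤
      8 * epochVariation F τ T e + 3 * underestimation F a ζ τ e j T ω + criticalGap τ K +
      rareCost F a ζ τ e (ω t).1 T (mean F (e * τ) j - mean F (e * τ) (ω t).1) t ω := by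
  have hv := epochVariation_nonneg F τ T e
  have hZ := underestimation_nonneg (F := F) (a := a) (ζ := ζ) (τ := τ) (T := T) e j ω
  have hδ := criticalGap_pos hτ (Fin.pos j)
  have hdrift := gap_le_mean_sub_mean_add hτ ht he hj ω
  rcases hadm.mean_sub_mean_le_or hF ha hζ hτ ht he j rfl with hsmall | hrare
  · linarith [rareCost_nonneg (F := F) (a := a) (ζ := ζ) (τ := τ) (T := T)
      (sub_nonneg.2 (hj (ω t).1)) e (ω t).1 t ω]
  · rw [rareCost, if_pos hrare]
    linarith

lemma sum_epoch_gap_le (hF : HeavyTailed F T) (ha : 1 < a) (hζ : 0 < ζ) (hτ : 0 < τ) {e : ℕ}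
    {j : Fin K} (hj : ∀ k, mean F (e * τ) k ≤ mean F (e * τ) j) {ω : ℕ → Fin K × ℝ}
    (hadm : ∀ t < T, Admissible a ζ τ (past t ω) (ω t).1) :
    ∑ t ∈ Finset.range T with t / τ = e, gap F t ω ≤
      τ * (8 * epochVariation F τ T e + 3 * underestimation F a ζ τ e j T ω + criticalGap τ K) +
      ∑ k, armCost F a ζ τ e k T (mean F (e * τ) j - mean F (e * τ) k) ω := by
  have hv := epochVariation_nonneg F τ T e
  have hZ := underestimation_nonneg (F := F) (a := a) (ζ := ζ) (τ := τ) (T := T) e j ω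
  have hδ := criticalGap_pos hτ (Fin.pos j)
  refine (Finset.sum_le_sum fun t ht => gap_le_add_rareCost hF ha hζ hτ
    (Finset.mem_range.1 (Finset.mem_filter.1 ht).1) (Finset.mem_filter.1 ht).2 hj
    (hadm t (Finset.mem_range.1 (Finset.mem_filter.1 ht).1))).trans ?_
  rw [Finset.sum_add_distrib, Finset.sum_const, nsmul_eq_mul]
  refine add_le_add (mul_le_mul_of_nonneg_right (Nat.cast_le.2 (card_epoch_le hτ T e))
    (by positivity)) ?_
  rw [← Finset.sum_fiberwise _ fun t => (ω t).1]
  refine Finset.sum_le_sum fun k _ => le_of_eq_of_le ?_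
    (sum_rareCost_le_armCost (sub_nonneg.2 (hj k)) e k ω)
  rw [Finset.filter_filter]
  exact Finset.sum_congr rfl fun t ht => by rw [(Finset.mem_filter.1 ht).2.2]

/-- The constant of the regret bound for one epoch. -/
def epochConst (a ζ : ℝ) : ℝ :=
  5 + 3 * (2 * (1 + √a) / (√a - 1) / devRate a ζ) +
    (2 * (12 * (1 + ζ)) ^ 2 + 24 * 6 ^ 4 / devRate a ζ ^ 4)

lemma two_le_epochConst (ha : 1 < a) (hζ : 0 < ζ) : 2 ≤ epochConst a ζ := by
  have hc := devRate_pos (zero_lt_one.trans ha) hζ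
  have hb : 0 < √a - 1 := sub_pos.2 (Real.lt_sqrt_of_sq_lt (by simpa using ha))
  have hZ : 0 ≤ 3 * (2 * (1 + √a) / (√a - 1) / devRate a ζ) := by positivity
  have hA : 0 ≤ 2 * (12 * (1 + ζ)) ^ 2 + 24 * 6 ^ 4 / devRate a ζ ^ 4 := by positivity
  rw [epochConst]
  linarith

lemma integrable_sum_gap [IsFiniteMeasure P] (s : Finset ℕ) :
    Integrable (fun ω => ∑ t ∈ s, gap F t ω) P :=
  integrable_finsetSum _ fun t _ => integrable_gap t

lemma HeavyTailed.integral_sum_gap_le [IsProbabilityMeasure P] (hF : HeavyTailed F T)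
    {s : Finset ℕ} (hs : s ⊆ Finset.range T) : ∫ ω, ∑ t ∈ s, gap F t ω ∂P ≤ s.card * 2 := by
  calc _ ≤ ∫ _, (s.card * 2 : ℝ) ∂P :=
        integral_mono (integrable_sum_gap s) (integrable_const _) fun ω => by
          simpa only [nsmul_eq_mul] using Finset.sum_le_card_nsmul s _ 2 fun t ht =>
            hF.gap_le_two (Finset.mem_range.1 (hs ht)) ω
    _ = s.card * 2 := by simp

namespace IsPathLaw

lemma integral_sum_epoch_gap_le_sum (hP : IsPathLaw π F T P) (hF : HeavyTailed F T)
    (ha : 1 < a) (hζ : 0 < ζ) (hψ : psi (2 * ζ / a) ≥ 2 * a / ζ) (hτ : 0 < τ)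
    (hπ : IsRRMOSS a ζ τ π) {e : ℕ} {j : Fin K}
    (hj : ∀ k, mean F (e * τ) k ≤ mean F (e * τ) j) :
    ∫ ω, ∑ t ∈ Finset.range T with t / τ = e, gap F t ω ∂P ≤
      τ * (8 * epochVariation F τ T e + 3 * ∫ ω, underestimation F a ζ τ e j T ω ∂P
        + criticalGap τ K) +
      ∑ k, ∫ ω, armCost F a ζ τ e k T (mean F (e * τ) j - mean F (e * τ) k) ω ∂P := by
  have := hP.isProbabilityMeasure
  have hZ := hP.integrable_underestimation hF ha hζ hψ hτ e j
  have hlevel := (((integrable_const (8 * epochVariation F τ T e)).add (hZ.const_mul 3)).add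
    (integrable_const (criticalGap τ K))).const_mul (τ : ℝ)
  have hcost := integrable_finsetSum Finset.univ fun k (_ : k ∈ Finset.univ) =>
    integrable_armCost (P := P) (F := F) (T := T) (a := a) (ζ := ζ) (τ := τ) e k
      (mean F (e * τ) j - mean F (e * τ) k)
  calc _ ≤ _ := integral_mono_ae (integrable_sum_gap _) (hlevel.add hcost) <| by
        filter_upwards [hP.ae_admissible hπ] with ω hω using sum_epoch_gap_le hF ha hζ hτ hj hω
    _ = _ := by
        rw [integral_add' hlevel hcost, integral_const_mul,
          integral_add' ((integrable_const _).add (hZ.const_mul 3)) (integrable_const _),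
          integral_add' (integrable_const _) (hZ.const_mul 3),
          integral_finsetSum _ fun k _ => integrable_armCost e k _]
        simp only [integral_const_mul, integral_const, probReal_univ, one_smul]

lemma integral_sum_epoch_gap_le_of_le (hP : IsPathLaw π F T P) (hF : HeavyTailed F T)
    (ha : 1 < a) (hζ : 0 < ζ) (hψ : psi (2 * ζ / a) ≥ 2 * a / ζ) (hτ : 0 < τ) (hK : 0 < K)
    (hKτ : K ≤ τ) (hπ : IsRRMOSS a ζ τ π) {e : ℕ} (he : e * τ < T) :
    ∫ ω, ∑ t ∈ Finset.range T with t / τ = e, gap F t ω ∂P ≤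
      epochConst a ζ * (τ * criticalGap τ K) + 8 * τ * epochVariation F τ T e := by
  have : Nonempty (Fin K) := ⟨⟨0, hK⟩⟩
  have hδ := criticalGap_pos hτ hK
  have hKδ := div_criticalGap hτ hK
  obtain ⟨j, hj⟩ := Finite.exists_max (mean F (e * τ))
  have hsum := hP.integral_sum_epoch_gap_le_sum hF ha hζ hψ hτ hπ hj
  have hZ := hP.integral_underestimation_le hF ha hζ hψ hτ e j
  have harm (k : Fin K) := hP.integral_armCost_le hF ha hζ hψ hτ e k
    (Δ := mean F (e * τ) j - mean F (e * τ) k) <| by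
      linarith [(abs_le.1 (hF.abs_mean_le_one he j)).2, (abs_le.1 (hF.abs_mean_le_one he k)).1]
  set δ := criticalGap τ K with hδ_def
  set v := epochVariation F τ T e
  set Z := ∫ ω, underestimation F a ζ τ e j T ω ∂P
  set A := 2 * (12 * (1 + ζ)) ^ 2 + 24 * 6 ^ 4 / devRate a ζ ^ 4 with hA
  have hKle : (K : ℝ) ≤ τ * δ := by
    rw [← hKδ, le_div_iff₀ hδ]
    refine mul_le_of_le_one_right (Nat.cast_nonneg K) ?_
    rw [hδ_def, criticalGap, Real.sqrt_le_one, div_le_one (Nat.cast_pos.2 hτ)]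
    exact Nat.cast_le.2 hKτ
  have harms := Finset.sum_le_card_nsmul Finset.univ _ _ fun k _ => harm k
  rw [Finset.card_univ, Fintype.card_fin, nsmul_eq_mul] at harms
  calc _ ≤ τ * (8 * v + 3 * Z + δ) + K * (4 + A / δ) := hsum.trans (add_le_add_right harms _)
    _ = 8 * τ * v + τ * δ + 3 * τ * Z + (4 * K + A * (K / δ)) := by ring
    _ ≤ 8 * τ * v + τ * δ + 3 * τ * (2 * (1 + √a) / (√a - 1) / devRate a ζ * δ)
          + (4 * (τ * δ) + A * (τ * δ)) := by
        rw [hKδ]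
        gcongr
    _ = _ := by
        rw [epochConst, ← hA]
        ring

lemma integral_sum_epoch_gap_le (hP : IsPathLaw π F T P) (hF : HeavyTailed F T)
    (ha : 1 < a) (hζ : 0 < ζ) (hψ : psi (2 * ζ / a) ≥ 2 * a / ζ) (hτ : 0 < τ) (hK : 0 < K)
    (hπ : IsRRMOSS a ζ τ π) {e : ℕ} (he : e * τ < T) :
    ∫ ω, ∑ t ∈ Finset.range T with t / τ = e, gap F t ω ∂P ≤
      epochConst a ζ * (τ * criticalGap τ K) + 8 * τ * epochVariation F τ T e := by
  rcases le_or_gt K τ with hKτ | hKτ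
  · exact hP.integral_sum_epoch_gap_le_of_le hF ha hζ hψ hτ hK hKτ hπ he
  have := hP.isProbabilityMeasure
  have hδ : 1 ≤ criticalGap τ K := by
    rw [criticalGap, Real.one_le_sqrt, one_le_div (Nat.cast_pos.2 hτ)]
    exact Nat.cast_le.2 hKτ.le
  have hC := two_le_epochConst ha hζ
  have hv := epochVariation_nonneg F τ T e
  calc _ ≤ ({t ∈ Finset.range T | t / τ = e}.card * 2 : ℝ) :=
        hF.integral_sum_gap_le (Finset.filter_subset _ _)
    _ ≤ τ * 2 := by
        gcongr
        exact card_epoch_le hτ T e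
    _ = 2 * (τ * 1) := by ring
    _ ≤ epochConst a ζ * (τ * criticalGap τ K) := by gcongr
    _ ≤ _ := le_add_of_nonneg_right (by positivity)

end IsPathLaw

/-! ### The regret over the horizon -/

lemma regret_le_two_mul (hF : HeavyTailed F T) (hK : 0 < K) : regret π F T ≤ 2 * T := by
  obtain ⟨P, hP⟩ := exists_isPathLaw hK π F T
  have := hP.isProbabilityMeasure
  rw [hP.regret_eq hF]
  refine (hF.integral_sum_gap_le subset_rfl).trans_eq ?_
  rw [Finset.card_range, mul_comm]

lemma card_epochs_mul_le (hτT : τ ≤ T) : ((Finset.range T).image (· / τ)).card * τ ≤ 2 * T := by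
  have hsub : (Finset.range T).image (· / τ) ⊆ Finset.range (T / τ + 1) :=
    Finset.image_subset_iff.2 fun t ht => Finset.mem_range.2 <|
      Nat.lt_succ_of_le (Nat.div_le_div_right (Finset.mem_range.1 ht).le)
  calc _ ≤ (T / τ + 1) * τ :=
        Nat.mul_le_mul_right _ ((Finset.card_le_card hsub).trans_eq (Finset.card_range _))
    _ = T / τ * τ + τ := by ring
    _ ≤ T + T := add_le_add (Nat.div_mul_le_self T τ) hτT
    _ = 2 * T := by ring

lemma regret_le_of_isRRMOSS {V : ℝ} (hF : F ∈ envClass V T K) (ha : 1 < a) (hζ : 0 < ζ)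
    (hψ : psi (2 * ζ / a) ≥ 2 * a / ζ) (hτ : 0 < τ) (hτT : τ ≤ T) (hK : 0 < K)
    (hπ : IsRRMOSS a ζ τ π) :
    regret π F T ≤ 2 * epochConst a ζ * (T * criticalGap τ K) + 8 * τ * V := by
  obtain ⟨hF, hV⟩ := hF
  obtain ⟨P, hP⟩ := exists_isPathLaw hK π F T
  have := hP.isProbabilityMeasure
  have hC : 0 ≤ epochConst a ζ := zero_le_two.trans (two_le_epochConst ha hζ)
  have hδ := criticalGap_pos hτ hK
  have hcard : (((Finset.range T).image (· / τ)).card : ℝ) * τ ≤ 2 * T := by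
    exact_mod_cast card_epochs_mul_le hτT
  calc regret π F T = ∑ e ∈ (Finset.range T).image (· / τ),
          ∫ ω, ∑ t ∈ Finset.range T with t / τ = e, gap F t ω ∂P := by
        rw [hP.regret_eq hF, ← integral_finsetSum _ fun e _ => integrable_sum_gap _]
        exact integral_congr_ae (ae_of_all _ fun ω =>
          (Finset.sum_fiberwise_of_maps_to (fun t ht => Finset.mem_image_of_mem _ ht) _).symm)
    _ ≤ ∑ e ∈ (Finset.range T).image (· / τ),
          (epochConst a ζ * (τ * criticalGap τ K) + 8 * τ * epochVariation F τ T e) := by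
        refine Finset.sum_le_sum fun e he => ?_
        obtain ⟨t, ht, rfl⟩ := Finset.mem_image.1 he
        exact hP.integral_sum_epoch_gap_le hF ha hζ hψ hτ hK hπ
          ((Nat.div_mul_le_self t τ).trans_lt (Finset.mem_range.1 ht))
    _ = ((Finset.range T).image (· / τ)).card * τ * (epochConst a ζ * criticalGap τ K)
          + 8 * τ * totalVariation F T := by
        rw [Finset.sum_add_distrib, Finset.sum_const, nsmul_eq_mul, ← Finset.mul_sum,
          sum_epochVariation]
        ring
    _ ≤ 2 * T * (epochConst a ζ * criticalGap τ K) + 8 * τ * V := by gcongr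
    _ = _ := by ring

end Epoch

/-! ### The choice of the period -/

/-- The epoch length `K^{1/3} (T / V)^{2/3}` before rounding, at which the two terms of the regret
bound are balanced. -/
def resetScale (K T : ℕ) (V : ℝ) : ℝ := (K : ℝ) ^ (1 / 3 : ℝ) * ((T : ℝ) / V) ^ (2 / 3 : ℝ)

/-- The rate `(K V)^{1/3} T^{2/3}` of the worst-case regret. -/
def regretRate (K T : ℕ) (V : ℝ) : ℝ := ((K : ℝ) * V) ^ (1 / 3 : ℝ) * (T : ℝ) ^ (2 / 3 : ℝ)

section Rate

variable {K T : ℕ} {V : ℝ}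

lemma resetScale_pos (hK : 0 < K) (hT : 0 < T) (hV : 0 < V) : 0 < resetScale K T V := by
  unfold resetScale
  positivity

lemma regretRate_nonneg (K T : ℕ) (hV : 0 ≤ V) : 0 ≤ regretRate K T V := by
  unfold regretRate
  positivity

lemma resetScale_le_resetPeriod (K T : ℕ) (V : ℝ) : resetScale K T V ≤ resetPeriod K T V :=
  Nat.le_ceil _

lemma resetPeriod_pos (hK : 0 < K) (hT : 0 < T) (hV : 0 < V) : 0 < resetPeriod K T V :=
  Nat.ceil_pos.2 (resetScale_pos hK hT hV)

lemma resetScale_mul_eq_regretRate (K T : ℕ) (hV : 0 < V) :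
    resetScale K T V * V = regretRate K T V := by
  have hVpow : V = V ^ (1 / 3 : ℝ) * V ^ (2 / 3 : ℝ) := by
    rw [← Real.rpow_add hV]
    norm_num
  rw [resetScale, regretRate, Real.div_rpow (by positivity) hV.le,
    Real.mul_rpow (by positivity) hV.le]
  nth_rw 2 [hVpow]
  field_simp

lemma sq_mul_eq_regretRate_sq_mul_resetScale (K T : ℕ) (hV : 0 < V) :
    (T : ℝ) ^ 2 * K = regretRate K T V ^ 2 * resetScale K T V := by
  have hcube : ∀ x : ℝ, 0 ≤ x → (x ^ (1 / 3 : ℝ)) ^ 3 = x := fun x hx => by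
    rw [← Real.rpow_natCast, ← Real.rpow_mul hx]
    norm_num
  have hsq : ∀ x : ℝ, 0 ≤ x → x ^ (2 / 3 : ℝ) = (x ^ (1 / 3 : ℝ)) ^ 2 := fun x hx => by
    rw [← Real.rpow_natCast, ← Real.rpow_mul hx]
    norm_num
  rw [regretRate, resetScale, Real.div_rpow (by positivity) hV.le,
    Real.mul_rpow (by positivity) hV.le, hsq T (by positivity), hsq V hV.le]
  nth_rw 1 [← hcube T (by positivity), ← hcube K (by positivity)]
  field_simp

lemma mul_criticalGap_resetPeriod_le (hK : 0 < K) (hT : 0 < T) (hV : 0 < V) :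
    T * criticalGap (resetPeriod K T V) K ≤ regretRate K T V := by
  have hτ := resetPeriod_pos hK hT hV
  refine (sq_le_sq₀ (by positivity [criticalGap_pos hτ hK]) (regretRate_nonneg K T hV.le)).1 ?_
  rw [mul_pow, sq_criticalGap, mul_div_assoc', sq_mul_eq_regretRate_sq_mul_resetScale K T hV,
    div_le_iff₀ (Nat.cast_pos.2 hτ)]
  gcongr
  exact resetScale_le_resetPeriod K T V

lemma resetPeriod_mul_le (hV : 0 < V) (h : 1 ≤ resetScale K T V) :
    resetPeriod K T V * V ≤ 2 * regretRate K T V := by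
  have hceil : (resetPeriod K T V : ℝ) ≤ 2 * resetScale K T V := by
    linarith [show (resetPeriod K T V : ℝ) < resetScale K T V + 1 from
      Nat.ceil_lt_add_one (zero_le_one.trans h)]
  calc _ ≤ 2 * resetScale K T V * V := by gcongr
    _ = 2 * regretRate K T V := by rw [mul_assoc, resetScale_mul_eq_regretRate K T hV]

lemma le_regretRate_of_resetScale_le_one (hK : 0 < K) (hV : 0 < V) (h : resetScale K T V ≤ 1) :
    T ≤ regretRate K T V := by
  refine (sq_le_sq₀ (Nat.cast_nonneg T) (regretRate_nonneg K T hV.le)).1 ?_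
  calc (T : ℝ) ^ 2 ≤ T ^ 2 * K := le_mul_of_one_le_right (by positivity) (Nat.one_le_cast.2 hK)
    _ = regretRate K T V ^ 2 * resetScale K T V := sq_mul_eq_regretRate_sq_mul_resetScale K T hV
    _ ≤ regretRate K T V ^ 2 := mul_le_of_le_one_right (by positivity) h

lemma regret_le_regretRate {π : Policy K} {F : Environment K} {a ζ : ℝ} (hF : F ∈ envClass V T K)
    (ha : 1 < a) (hζ : 0 < ζ) (hψ : psi (2 * ζ / a) ≥ 2 * a / ζ) (hK : 0 < K) (hT : 0 < T)
    (hV : 0 < V) (hτT : resetPeriod K T V ≤ T) (hπ : IsRRMOSS a ζ (resetPeriod K T V) π) :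
    regret π F T ≤ (2 * epochConst a ζ + 16) * regretRate K T V := by
  have hC := two_le_epochConst ha hζ
  have hG := regretRate_nonneg K T hV.le
  rcases le_total (resetScale K T V) 1 with hscale | hscale
  · calc regret π F T ≤ 2 * T := regret_le_two_mul hF.1 hK
      _ ≤ 2 * regretRate K T V := by
          gcongr
          exact le_regretRate_of_resetScale_le_one hK hV hscale
      _ ≤ _ := by
          gcongr
          linarith
  · calc _ ≤ 2 * epochConst a ζ * (T * criticalGap (resetPeriod K T V) K)
          + 8 * (resetPeriod K T V * V) := by
          rw [← mul_assoc 8]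
          exact regret_le_of_isRRMOSS hF ha hζ hψ (resetPeriod_pos hK hT hV) hτT hK hπ
      _ ≤ 2 * epochConst a ζ * regretRate K T V + 8 * (2 * regretRate K T V) := by
          have hτδ := mul_criticalGap_resetPeriod_le hK hT hV
          have hτV := resetPeriod_mul_le hV hscale
          gcongr ?_ * ?_ + 8 * ?_
      _ = _ := by ring

end Rate

end NonstationaryBandit

end

open NonstationaryBandit in
theorem theorem4 (a ζ : ℝ) (ha : 1 < a) (hζ : 0 < ζ)
    (hψ : NonstationaryBandit.psi (2 * ζ / a) ≥ 2 * a / ζ) :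
    ∃ C : ℝ, 0 < C ∧ ∀ (K T : ℕ) (V : ℝ), 1 ≤ K → 1 ≤ T → 0 < V →
      NonstationaryBandit.resetPeriod K T V ≤ T →
        ∀ π : NonstationaryBandit.Policy K,
          NonstationaryBandit.IsRRMOSS a ζ (NonstationaryBandit.resetPeriod K T V) π →
            NonstationaryBandit.worstCaseRegret π V T ≤
              ((C * ((K : ℝ) * V) ^ (1 / 3 : ℝ) * (T : ℝ) ^ (2 / 3 : ℝ) : ℝ) : EReal) := by
  have hC := two_le_epochConst ha hζ
  refine ⟨2 * epochConst a ζ + 16, by linarith, fun K T V hK hT hV hτT π hπ => ?_⟩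
  refine iSup₂_le fun F hF => EReal.coe_le_coe_iff.2 ?_
  rw [mul_assoc]
  exact regret_le_regretRate hF ha hζ hψ hK hT hV hτT hπ
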